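/- Let $d\ge 1$ and let $\phi:\mathbb R^d\to[0,\infty)$ be even, $\phi(-x)=\phi(x)$, and integrable. Let $\Gamma_0$ be the space of finite subsets of $\mathbb R^d$ with the Lebesgue–Poisson measure $\lambda=\delta_{\emptyset}+\sum_{n\ge1}\frac1{n!}m^{(n)}$, where $m^{(n)}$ is the image of Lebesgue measure on $n$-tuples of distinct points under $(x_1,\dots,x_n)\mapsto\{x_1,\dots,x_n\}$. For $f:\mathbb R^d\to\mathbb R$ put $e(f,\eta)=\prod_{x\in\eta}f(x)$. For $\alpha\in\mathbb R$ let $\mathcal K_\alpha$ be the Banach space of ($\lambda$-classes of) measurable $k:\Gamma_0\to\mathbb R$ with $\|k\|_\alpha=\operatorname{ess\,sup}_{\eta}|k(\eta)|e^{\alpha|\eta|}<\infty$, and let $\varDelta^+_\alpha=\{\varrho\in L^\infty(\mathbb R^d): 0\le\varrho\le e^{-\alpha}\text{ a.e.}\}$. For $\varkappa>0$ consider the Vlasov operator $$(L_Vk)(\eta)=-|\eta|k(\eta)+\varkappa\sum_{x\in\eta}\int_{\Gamma_0}e(-\phi(x-\cdot),\xi)\,k((\eta\setminus x)\cup\xi)\,\lambda(d\xi),$$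 taken in $\mathcal K_\alpha$ with domain the set of those $k\in\mathcal K_\alpha$ for which the integrals converge absolutely for $\lambda$-a.e. $\eta$ and $L_Vk\in\mathcal K_\alpha$. A classical solution on $[0,T)$, $0<T\le\infty$, of a Cauchy problem $\frac{du}{dt}=Au$, $u|_{t=0}=u_0$, in a Banach space $X$ is a map $u:[0,T)\to X$ that is continuous on $[0,T)$, continuously differentiable in $X$ on $(0,T)$, with $u(0)=u_0$ and, for all $t\in(0,T)$, $u(t)$ in the domain of $A$ and $u'(t)=Au(t)$. **Theorem.** Let $\varkappa>0$ and $\alpha_0\in\mathbb R$ satisfy $\varkappa\le e^{-\alpha_0}$, and let $\varrho_0\in\varDelta^+_{\alpha_0}$. Then the problem $$\frac{d\varrho_t}{dt}=-\varrho_t+\varkappa\exp(-\phi*\varrho_t),\qquad \varrho_t|_{t=0}=\varrho_0,\qquad (\phi*\varrho)(x)=\int_{\mathbb R^d}\phi(x-y)\varrho(y)\,dy,$$ has a classical solution $(\varrho_t)_{t\ge0}$ in $L^\infty(\mathbb R^d)$ on $[0,\infty)$; it is unique (any classical solution in $L^\infty(\mathbb R^d)$ on some $[0,T)$ coincides with it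 on $[0,T)$), and $\varrho_t\in\varDelta^+_{\alpha_0}$ for all $t\ge0$. Moreover, for every $\alpha<\alpha_0$, the function $e(\varrho_0,\cdot)$ belongs to $\mathcal K_\alpha$, and the Vlasov hierarchy $$\frac{dr_t}{dt}=L_Vr_t,\qquad r_t|_{t=0}=e(\varrho_0,\cdot),$$ has a classical solution $(r_t)_{t\ge0}$ in $\mathcal K_\alpha$ on $[0,\infty)$; it is unique (any classical solution in $\mathcal K_\alpha$ on some $[0,T)$ coincides with it on $[0,T)$), and it is given by $$r_t(\eta)=e(\varrho_t,\eta)=\prod_{x\in\eta}\varrho_t(x)\qquad\text{for all }t\ge0\text{ and }\lambda\text{-a.e. }\eta\in\Gamma_0.$$ -/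

import Mathlib

open MeasureTheory Filter Topology
open scoped ENNReal

noncomputable section

namespace Vlasov

/-- The position space `ℝ^d`. -/
abbrev Pos (d : ℕ) : Type := EuclideanSpace ℝ (Fin d)

/-- Finite configurations: finite subsets of `ℝ^d`. (A wrapper is used because the `σ`-algebra that
Mathlib puts on `Finset` is not the one needed here.) -/
@[ext]
structure Conf (d : ℕ) : Type where
  /-- The underlying finite set of points. -/
  pts : Finset (Pos d)

/-- The number of points of a configuration. -/
def Conf.card {d : ℕ} (η : Conf d) : ℕ := η.pts.card

open scoped Classical in
/-- The configuration `(η \ x) ∪ ξ`. -/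
def Conf.replace {d : ℕ} (η : Conf d) (x : Pos d) (ξ : Conf d) : Conf d :=
  ⟨η.pts.erase x ∪ ξ.pts⟩

/-- The `n`-tuples of pairwise distinct points of `ℝ^d`. -/
abbrev DistinctTuple (d n : ℕ) : Type := {x : Fin n → Pos d // Function.Injective x}

/-- The symmetrization map: a tuple of distinct points goes to the set of its entries. -/
def toConf (d n : ℕ) (x : DistinctTuple d n) : Conf d :=
  ⟨Finset.univ.map ⟨x.1, x.2⟩⟩

/-- The Borel `σ`-algebra of the space of finite configurations, i.e. of the disjoint union over `n`
of the quotients of the spaces of distinct `n`-tuples by permutations: a set is measurable iff all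
its preimages in the spaces of distinct tuples are Borel. -/
instance instMeasurableSpaceConf (d : ℕ) : MeasurableSpace (Conf d) :=
  ⨅ n : ℕ, MeasurableSpace.map (toConf d n) inferInstance

theorem measurableSet_conf_iff {d : ℕ} {A : Set (Conf d)} :
    MeasurableSet A ↔ ∀ n, MeasurableSet (toConf d n ⁻¹' A) := by
  change MeasurableSet[⨅ n : ℕ, MeasurableSpace.map (toConf d n) inferInstance] A ↔ _
  rw [MeasurableSpace.measurableSet_iInf]
  rfl

/-- The Lebesgue–Poisson measure `δ_∅ + ∑_{n ≥ 1} m^{(n)} / n!` on finite configurations, where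
`m^{(n)}` is the image of Lebesgue measure on distinct `n`-tuples (the term `n = 0` is `δ_∅`). -/
def lebesguePoisson (d : ℕ) : Measure (Conf d) :=
  Measure.sum fun n : ℕ =>
    ((n.factorial : ℝ≥0∞)⁻¹) •
      Measure.map (toConf d n)
        (Measure.comap (fun x : DistinctTuple d n => x.1) (volume : Measure (Fin n → Pos d)))

/-- The Lebesgue–Poisson exponent `e(f, η) = ∏_{x ∈ η} f x`. -/
def lpExp {d : ℕ} (f : Pos d → ℝ) (η : Conf d) : ℝ := ∏ x ∈ η.pts, f x

/-- The weight `e^{α |η|}`. -/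
def weight {d : ℕ} (α : ℝ) (η : Conf d) : ℝ := Real.exp (α * (η.card : ℝ))

theorem measurable_weight {d : ℕ} (α : ℝ) : Measurable (weight (d := d) α) := by
  intro s _
  rw [measurableSet_conf_iff]
  intro n
  have h : ∀ x : DistinctTuple d n, weight α (toConf d n x) = Real.exp (α * (n : ℝ)) := by
    intro x
    simp [weight, toConf, Conf.card]
  by_cases hs : Real.exp (α * (n : ℝ)) ∈ s
  · convert MeasurableSet.univ
    ext x
    simp [h, hs]
  · convert MeasurableSet.empty
    ext x
    simp [h, hs]

/-- Classes of measurable functions `k` on finite configurations for which `|k(η)| e^{α |η|}` is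
essentially bounded. -/
def kSubmodule (d : ℕ) (α : ℝ) : Submodule ℝ (Conf d →ₘ[lebesguePoisson d] ℝ) where
  carrier := {k | MemLp (fun η => weight α η * k η) ∞ (lebesguePoisson d)}
  zero_mem' := by
    refine (MemLp.zero (ε := ℝ)).ae_eq ?_
    filter_upwards [AEEqFun.coeFn_zero (α := Conf d) (β := ℝ) (μ := lebesguePoisson d)] with η h
    simp [h]
  add_mem' := by
    intro a b ha hb
    refine (MemLp.add ha hb).ae_eq ?_
    filter_upwards [AEEqFun.coeFn_add a b] with η h
    simp [h, mul_add]
  smul_mem' := by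
    intro c a ha
    refine (MemLp.const_smul ha c).ae_eq ?_
    filter_upwards [AEEqFun.coeFn_smul c a] with η h
    simp only [h, Pi.smul_apply, smul_eq_mul]
    ring

/-- The Banach space `K_α` of (classes of) functions on finite configurations with norm
`ess sup |k(η)| e^{α |η|}`. -/
def KSpace (d : ℕ) (α : ℝ) : Type := kSubmodule d α

instance (d : ℕ) (α : ℝ) : AddCommGroup (KSpace d α) :=
  inferInstanceAs (AddCommGroup (kSubmodule d α))

instance (d : ℕ) (α : ℝ) : Module ℝ (KSpace d α) :=
  inferInstanceAs (Module ℝ (kSubmodule d α))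

/-- A representative of an element of `K_α`. -/
def KSpace.rep {d : ℕ} {α : ℝ} (k : KSpace d α) : Conf d → ℝ :=
  (k.1 : Conf d →ₘ[lebesguePoisson d] ℝ)

theorem KSpace.memLp_rep {d : ℕ} {α : ℝ} (k : KSpace d α) :
    MemLp (fun η => weight α η * k.rep η) ∞ (lebesguePoisson d) :=
  k.2

theorem KSpace.rep_add {d : ℕ} {α : ℝ} (a b : KSpace d α) :
    (a + b).rep =ᵐ[lebesguePoisson d] a.rep + b.rep :=
  AEEqFun.coeFn_add (a.1 : Conf d →ₘ[lebesguePoisson d] ℝ) b.1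

theorem KSpace.rep_smul {d : ℕ} {α : ℝ} (c : ℝ) (a : KSpace d α) :
    (c • a).rep =ᵐ[lebesguePoisson d] c • a.rep :=
  AEEqFun.coeFn_smul c (a.1 : Conf d →ₘ[lebesguePoisson d] ℝ)

/-- Multiplication by the weight, `k ↦ e^{α |·|} k`, from `K_α` to the unweighted `L^∞`. -/
def KSpace.toLinfty (d : ℕ) (α : ℝ) : KSpace d α →ₗ[ℝ] Lp ℝ ∞ (lebesguePoisson d) where
  toFun k := MemLp.toLp (fun η => weight α η * k.rep η) k.memLp_rep
  map_add' := by
    intro a b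
    rw [← MemLp.toLp_add, MemLp.toLp_eq_toLp_iff]
    filter_upwards [KSpace.rep_add a b] with η h
    simp [h, mul_add]
  map_smul' := by
    intro c a
    rw [RingHom.id_apply, ← MemLp.toLp_const_smul, MemLp.toLp_eq_toLp_iff]
    filter_upwards [KSpace.rep_smul c a] with η h
    simp only [h, Pi.smul_apply, smul_eq_mul]
    ring

theorem KSpace.toLinfty_injective (d : ℕ) (α : ℝ) :
    Function.Injective (KSpace.toLinfty d α) := by
  intro a b hab
  have h := (MemLp.toLp_eq_toLp_iff a.memLp_rep b.memLp_rep).1 hab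
  refine Subtype.ext (AEEqFun.ext ?_)
  filter_upwards [h] with η hη
  exact mul_left_cancel₀ (Real.exp_pos _).ne' hη

/-- The norm of `K_α`, defined so that `k ↦ e^{α |·|} k` is an isometry into `L^∞`. -/
instance (d : ℕ) (α : ℝ) : NormedAddCommGroup (KSpace d α) :=
  NormedAddCommGroup.induced _ _ (KSpace.toLinfty d α) (KSpace.toLinfty_injective d α)

instance (d : ℕ) (α : ℝ) : NormedSpace ℝ (KSpace d α) :=
  NormedSpace.induced ℝ _ _ (KSpace.toLinfty d α)

/-- The norm is the essential supremum of `|k(η)| e^{α |η|}`. -/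
theorem KSpace.norm_eq {d : ℕ} {α : ℝ} (k : KSpace d α) :
    ‖k‖ = (eLpNorm (fun η => weight α η * k.rep η) ∞ (lebesguePoisson d)).toReal :=
  Lp.norm_toLp _ k.memLp_rep

/-- `u` is a classical solution on `[0, T)` (where `T ≤ ∞`), in the normed space `X`, of the Cauchy
problem `du/dt = A u`, `u 0 = u₀`. The (possibly nonlinear, not everywhere defined) operator `A`
is given by its graph: `A v w` means that `v` is in the domain and `w` is its image. -/
structure IsClassicalSolution {X : Type*} [NormedAddCommGroup X] [NormedSpace ℝ X]
    (A : X → X → Prop) (u₀ : X) (T : EReal) (u : ℝ → X) : Prop where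
  initial : u 0 = u₀
  continuousOn : ContinuousOn u {t : ℝ | 0 ≤ t ∧ (t : EReal) < T}
  differentiableAt : ∀ t : ℝ, 0 < t → (t : EReal) < T → DifferentiableAt ℝ u t
  continuousOn_deriv : ContinuousOn (deriv u) {t : ℝ | 0 < t ∧ (t : EReal) < T}
  equation : ∀ t : ℝ, 0 < t → (t : EReal) < T → A (u t) (deriv u t)

/-- The operator of the Vlasov hierarchy, acting on functions on finite configurations:
`-|η| k(η) + ϰ ∑_{x ∈ η} ∫ e(-φ(x - ·), ξ) k((η \ x) ∪ ξ) λ(dξ)`. -/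
def vlasovOp {d : ℕ} (φ : Pos d → ℝ) (ϰ : ℝ) (k : Conf d → ℝ) (η : Conf d) : ℝ :=
  -(η.card : ℝ) * k η +
    ϰ * ∑ x ∈ η.pts, ∫ ξ, lpExp (fun y => -φ (x - y)) ξ * k (η.replace x ξ) ∂(lebesguePoisson d)

/-- The graph of the Vlasov operator as an unbounded operator in `K_α`: the integrals converge
absolutely for almost all `η`, and the resulting function is the element `g` of `K_α`. -/
def VlasovGraph {d : ℕ} (φ : Pos d → ℝ) (ϰ α : ℝ) (k g : KSpace d α) : Prop :=
  (∀ᵐ η ∂(lebesguePoisson d), ∀ x ∈ η.pts,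
      Integrable (fun ξ => lpExp (fun y => -φ (x - y)) ξ * k.rep (η.replace x ξ))
        (lebesguePoisson d)) ∧
    g.rep =ᵐ[lebesguePoisson d] vlasovOp φ ϰ k.rep

/-- The graph in `L^∞(ℝ^d)` of the right-hand side `ϱ ↦ -ϱ + ϰ exp(-(φ ∗ ϱ))` of the Vlasov
equation. -/
def VlasovEqGraph {d : ℕ} (φ : Pos d → ℝ) (ϰ : ℝ)
    (ϱ g : Lp ℝ ∞ (volume : Measure (Pos d))) : Prop :=
  g =ᵐ[volume] fun x => -ϱ x + ϰ * Real.exp (-∫ y, φ (x - y) * ϱ y)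

/-- The set of `ϱ ∈ L^∞(ℝ^d)` with `ϱ ≥ 0` almost everywhere and `‖ϱ‖_∞ ≤ e^{-α}`. -/
def DeltaPlus (d : ℕ) (α : ℝ) : Set (Lp ℝ ∞ (volume : Measure (Pos d))) :=
  {ϱ | ‖ϱ‖ ≤ Real.exp (-α) ∧ ∀ᵐ x, 0 ≤ ϱ x}

end Vlasov

end

/-! The density equation is an ordinary differential equation in `L^∞` of the form `u' = -u + H u`.
With `φ ∗ ϱ` replaced by its positive part, `H` is globally Lipschitz with values between `0` and
`ϰ`, so solutions are global (`exists_forall_hasDerivAt_neg_add`). `DeltaPlus d α₀` is a closed ball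
about a constant function, and `ϰ ≤ e^{-α₀}` says that the forcing term stays in this ball. Since
`u` relaxes towards the forcing, the ball is positively invariant. On it `φ ∗ ϱ ≥ 0`, so the
truncation is inactive and the true equation is solved. Uniqueness needs only that the untruncated
right-hand side is Lipschitz on bounded sets.

The product `e(ϱ_t, ·)` solves the hierarchy by the Leibniz rule, because `∫ e(f, ξ) λ(dξ) = exp(∫
f)` turns each integral in the Vlasov operator into `exp(-(φ ∗ ϱ)(x))` times the product over `η \
x` (`vlasovGraph_expVec`). Differentiability in the norm of `K_α` requires errors that are uniform
in `η`. They grow like `|η|` and `|η|²`, and the strict inequality `α < α₀` absorbs them through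
`e^{-(α₀-α)|η|}` (`hasDerivAt_expVec`).

Uniqueness for the hierarchy is the harder part, as no boundedness of the operator on `K_α` is
available. It is however bounded from `K_γ` to `K_β` for `β < γ`, with norm at most `C / (γ - β)`
(`norm_le_of_vlasovOp`). Let `w` be the difference of two solutions, with `‖w‖ ≤ M`. Descending from
`α` to `α - 1` in `N` equal steps and integrating once per step gives `‖w_t‖ ≤ M (CN)^N t^N / N! ≤ M
(C e t)^N` in `K_{α-1}`. This tends to `0` for short times. The inclusion into `K_{α-1}` is
injective, so `w` vanishes there, and the length of the time step does not depend on where it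
starts. -/

open MeasureTheory Filter Topology
open scoped ENNReal

noncomputable section

namespace Vlasov

/-! ### Ordinary differential equations in a normed space. -/

section ODE

open Set Metric
open scoped NNReal

variable {E : Type*} [NormedAddCommGroup E] [NormedSpace ℝ E]

/-- Mean value inequality with a majorant of the derivative in the interior of the interval. -/
theorem norm_sub_le_of_norm_deriv_le_Ioo {f f' : ℝ → E} {B B' : ℝ → ℝ} {a b : ℝ} (hab : a ≤ b)
    (hf : ContinuousOn f (Icc a b)) (hf' : ∀ t ∈ Ioo a b, HasDerivAt f (f' t) t)
    (hB : ∀ t, HasDerivAt B (B' t) t) (hle : ∀ t ∈ Ioo a b, ‖f' t‖ ≤ B' t) :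
    ‖f b - f a‖ ≤ B b - B a := by
  rcases hab.eq_or_lt with rfl | hab
  · simp
  have key : ∀ c ∈ Ioo a b, ‖f b - f c‖ ≤ B b - B c := by
    intro c hc
    have hcont : ContinuousOn (fun t => f t - f c) (Icc c b) :=
      (hf.mono (Icc_subset_Icc_left hc.1.le)).sub continuousOn_const
    refine image_norm_le_of_norm_deriv_right_le_deriv_boundary (a := c) (b := b)
      (f := fun t => f t - f c) (f' := f') (B := fun t => B t - B c) (B' := B') hcont
      (fun t ht => ?_) (by simp) (fun t => (hB t).sub_const _) (fun t ht => ?_)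
      (right_mem_Icc.2 hc.2.le)
    · exact ((hf' t ⟨hc.1.trans_le ht.1, ht.2⟩).sub_const _).hasDerivWithinAt
    · exact hle t ⟨hc.1.trans_le ht.1, ht.2⟩
  -- No derivative is given at `a`, so the bound on `[c, b]` is passed to the limit `c → a+` by
  -- continuity.
  have hlim : Tendsto f (𝓝[>] a) (𝓝 (f a)) :=
    ((hf a (left_mem_Icc.2 hab.le)).mono_of_mem_nhdsWithin
      (mem_of_superset (Ioo_mem_nhdsGT hab) Ioo_subset_Icc_self))
  have hlimB : Tendsto B (𝓝[>] a) (𝓝 (B a)) := (hB a).continuousAt.continuousWithinAt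
  refine le_of_tendsto_of_tendsto ((tendsto_const_nhds.sub hlim).norm)
    (tendsto_const_nhds.sub hlimB) ?_
  filter_upwards [Ioo_mem_nhdsGT hab] with c hc using key c hc

/-- Uniqueness for an autonomous equation whose right-hand side is Lipschitz on bounded sets, with
the equation required only at positive times. -/
theorem eqOn_Icc_of_hasDerivAt_Ioo {G : E → E} {f g : ℝ → E} {b : ℝ}
    (hG : ∀ R : ℝ, ∃ K : ℝ≥0, LipschitzOnWith K G (closedBall 0 R))
    (hf : ContinuousOn f (Icc 0 b)) (hf' : ∀ t ∈ Ioo 0 b, HasDerivAt f (G (f t)) t)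
    (hg : ContinuousOn g (Icc 0 b)) (hg' : ∀ t ∈ Ioo 0 b, HasDerivAt g (G (g t)) t)
    (h0 : f 0 = g 0) : EqOn f g (Icc 0 b) := by
  rcases lt_or_ge b 0 with hb | hb
  · simp [Icc_eq_empty_of_lt hb]
  rcases hb.eq_or_lt with rfl | hb
  · intro t ht
    simp only [Icc_self, mem_singleton_iff] at ht
    rw [ht, h0]
  have hGc : Continuous G := by
    rw [continuous_iff_continuousAt]
    intro x
    obtain ⟨K, hK⟩ := hG (‖x‖ + 1)
    refine hK.continuousOn.continuousAt (mem_of_superset (ball_mem_nhds x one_pos) ?_)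
    intro y hy
    rw [mem_closedBall_zero_iff]
    have := norm_sub_norm_le y x
    rw [mem_ball, dist_eq_norm] at hy
    linarith
  -- The right derivative at `0` exists because `u' = G ∘ u` has a limit there.
  have right : ∀ u : ℝ → E, ContinuousOn u (Icc 0 b) →
      (∀ t ∈ Ioo 0 b, HasDerivAt u (G (u t)) t) →
      ∀ t ∈ Ico 0 b, HasDerivWithinAt u (G (u t)) (Ici t) t := by
    intro u hu hu' t ht
    rcases ht.1.eq_or_lt with rfl | h
    · refine hasDerivWithinAt_Ici_of_tendsto_deriv (s := Ioo 0 b)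
        (fun t ht => (hu' t ht).differentiableAt.differentiableWithinAt)
        ((hu 0 (left_mem_Icc.2 hb.le)).mono Ioo_subset_Icc_self) (Ioo_mem_nhdsGT hb) ?_
      have h1 : Tendsto (fun t => G (u t)) (𝓝[>] 0) (𝓝 (G (u 0))) :=
        (hGc.tendsto _).comp ((hu 0 (left_mem_Icc.2 hb.le)).mono_of_mem_nhdsWithin
          (mem_of_superset (Ioo_mem_nhdsGT hb) Ioo_subset_Icc_self))
      refine h1.congr' ?_
      filter_upwards [Ioo_mem_nhdsGT hb] with t ht using (hu' t ht).deriv.symm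
    · exact (hu' t ⟨h, ht.2⟩).hasDerivWithinAt
  obtain ⟨C₁, hC₁⟩ := isCompact_Icc.exists_bound_of_continuousOn hf
  obtain ⟨C₂, hC₂⟩ := isCompact_Icc.exists_bound_of_continuousOn hg
  obtain ⟨K, hK⟩ := hG (max C₁ C₂)
  refine ODE_solution_unique_of_mem_Icc_right (v := fun _ => G)
    (s := fun _ => closedBall 0 (max C₁ C₂)) (K := K) (fun t _ => hK) hf (right f hf hf') ?_ hg
    (right g hg hg') ?_ h0
  · intro t ht
    rw [mem_closedBall_zero_iff]
    exact (hC₁ t (Ico_subset_Icc_self ht)).trans (le_max_left _ _)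
  · intro t ht
    rw [mem_closedBall_zero_iff]
    exact (hC₂ t (Ico_subset_Icc_self ht)).trans (le_max_right _ _)

theorem hasDerivAt_exp_neg_smul {y : ℝ → E} {v : E} {t : ℝ} (h : HasDerivAt y (Real.exp t • v) t) :
    HasDerivAt (fun s => Real.exp (-s) • y s) (-(Real.exp (-t) • y t) + v) t := by
  have h1 : HasDerivAt (fun s => Real.exp (-s)) (-Real.exp (-t)) t := by
    simpa using (hasDerivAt_neg t).exp
  refine (h1.smul h).congr_deriv ?_
  rw [smul_smul, ← Real.exp_add]
  simp [add_comm]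

theorem hasDerivAt_exp_smul {y : ℝ → E} {v : E} {t : ℝ} (h : HasDerivAt y (-y t + v) t) :
    HasDerivAt (fun s => Real.exp s • y s) (Real.exp t • v) t := by
  refine ((Real.hasDerivAt_exp t).smul h).congr_deriv ?_
  rw [smul_add, smul_neg]
  abel

/-- Local solutions of `u' = -u + H u` on arbitrarily long intervals. -/
theorem exists_hasDerivAt_Ioo_neg_add [CompleteSpace E] {H : E → E} {K : ℝ≥0} {M : ℝ}
    (hH : LipschitzWith K H) (hM : ∀ x, ‖H x‖ ≤ M) (x₀ : E) (T : ℝ) (hT : 0 < T) :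
    ∃ u : ℝ → E, u 0 = x₀ ∧ ∀ t ∈ Ioo (-T) T, HasDerivAt u (-(u t) + H (u t)) t := by
  have hM0 : 0 ≤ M := (norm_nonneg _).trans (hM x₀)
  -- This is the equation for `y = e^t u`. The exponentials cancel in the Lipschitz constant, and
  -- the field is bounded by `e^T M`. A ball of radius `e^T M T` therefore suffices for
  -- Picard–Lindelöf on all of `[-T, T]`.
  set f : ℝ → E → E := fun t y => Real.exp t • H (Real.exp (-t) • y) with hf
  have h0 : (0 : ℝ) ∈ Icc (-T) T := ⟨by linarith, hT.le⟩
  have hpl : IsPicardLindelof f (⟨0, h0⟩ : Icc (-T) T) x₀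
      (Real.toNNReal (Real.exp T * M * T)) 0 (Real.toNNReal (Real.exp T * M)) K := by
    constructor
    · intro t _
      refine LipschitzWith.lipschitzOnWith ?_
      refine LipschitzWith.of_dist_le_mul fun x y => ?_
      rw [hf, dist_smul₀]
      have := hH.dist_le_mul (Real.exp (-t) • x) (Real.exp (-t) • y)
      rw [dist_smul₀] at this
      simp only [Real.norm_eq_abs, Real.abs_exp] at this ⊢
      calc Real.exp t * dist (H (Real.exp (-t) • x)) (H (Real.exp (-t) • y))
          ≤ Real.exp t * (K * (Real.exp (-t) * dist x y)) := by gcongr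
        _ = (Real.exp t * Real.exp (-t)) * (K * dist x y) := by ring
        _ = K * dist x y := by rw [← Real.exp_add]; simp
    · intro x _
      refine Continuous.continuousOn ?_
      have := hH.continuous
      simp only [hf]
      fun_prop
    · intro t ht x _
      rw [hf, norm_smul, Real.norm_eq_abs, Real.abs_exp, Real.coe_toNNReal _ (by positivity)]
      have : Real.exp t ≤ Real.exp T := Real.exp_le_exp.2 ht.2
      gcongr
      exact hM _
    · rw [Real.coe_toNNReal _ (by positivity), Real.coe_toNNReal _ (by positivity)]
      simp
  obtain ⟨y, hy0, hy⟩ := hpl.exists_eq_forall_mem_Icc_hasDerivWithinAt₀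
  refine ⟨fun t => Real.exp (-t) • y t, by simpa using hy0, fun t ht => ?_⟩
  exact hasDerivAt_exp_neg_smul
    ((hy t (Ioo_subset_Icc_self ht)).hasDerivAt (Icc_mem_nhds ht.1 ht.2))

theorem exists_forall_hasDerivAt_neg_add [CompleteSpace E] {H : E → E} {K : ℝ≥0} {M : ℝ}
    (hH : LipschitzWith K H) (hM : ∀ x, ‖H x‖ ≤ M) (x₀ : E) :
    ∃ u : ℝ → E, u 0 = x₀ ∧ ∀ t, HasDerivAt u (-(u t) + H (u t)) t := by
  have hG : LipschitzWith (1 + K) (fun x => -x + H x) := LipschitzWith.id.neg.add hH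
  choose v hv0 hv using fun n : ℕ =>
    exists_hasDerivAt_Ioo_neg_add hH hM x₀ ((n : ℝ) + 1) (by positivity)
  have agree : ∀ m n : ℕ, m ≤ n → EqOn (v m) (v n) (Ioo (-((m : ℝ) + 1)) ((m : ℝ) + 1)) := by
    intro m n hmn
    have hmn' : (m : ℝ) ≤ n := by exact_mod_cast hmn
    refine ODE_solution_unique_of_mem_Ioo (v := fun _ x => -x + H x) (s := fun _ => univ)
      (t₀ := 0) (fun _ _ => hG.lipschitzOnWith) ⟨by linarith [m.cast_nonneg (α := ℝ)], by positivity⟩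
      (fun t ht => ⟨hv m t ht, mem_univ _⟩) (fun t ht => ⟨hv n t ⟨?_, ?_⟩, mem_univ _⟩)
      (by rw [hv0, hv0])
    · linarith [ht.1]
    · linarith [ht.2]
  -- Each `v n` solves on `(-(n+1), n+1)`, which contains every `t` with `⌈|t|⌉₊ = n`. One further
  -- unit in the index below makes a single `v n` serve a whole neighbourhood of `t`.
  refine ⟨fun t => v ⌈|t|⌉₊ t, by simpa using hv0 0, fun t => ?_⟩
  set n := ⌈|t|⌉₊ + 1 with hn
  have hlt : |t| < (n : ℝ) := by
    rw [hn]
    push_cast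
    linarith [Nat.le_ceil |t|]
  have heq : (fun t => v ⌈|t|⌉₊ t) =ᶠ[𝓝 t] v n := by
    have hnh : ∀ᶠ s : ℝ in 𝓝 t, |s| < (n : ℝ) := (continuous_abs.tendsto t).eventually_lt_const hlt
    filter_upwards [hnh] with s hs
    refine agree _ _ (Nat.ceil_le.2 hs.le) ?_
    have := abs_lt.1 (lt_of_le_of_lt (Nat.le_ceil |s|) (lt_add_one _))
    exact this
  have ht : t ∈ Ioo (-((n : ℝ) + 1)) ((n : ℝ) + 1) := abs_lt.1 (by linarith)
  have := (hv n t ht).congr_of_eventuallyEq heq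
  rw [← heq.eq_of_nhds] at this
  exact this

/-- A ball which contains the values of the forcing term is positively invariant. -/
theorem norm_sub_le_of_hasDerivAt_neg_add {u h : ℝ → E} {c : E} {R : ℝ}
    (hu : ∀ t, HasDerivAt u (-(u t) + h t) t) (hh : ∀ t, ‖h t - c‖ ≤ R) (h0 : ‖u 0 - c‖ ≤ R)
    {t : ℝ} (ht : 0 ≤ t) : ‖u t - c‖ ≤ R := by
  have hd : ∀ t, HasDerivAt (fun s => Real.exp s • (u s - c)) (Real.exp t • (h t - c)) t := by
    intro t
    refine hasDerivAt_exp_smul ?_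
    convert (hu t).sub_const c using 1
    abel
  have := norm_sub_le_of_norm_deriv_le_Ioo (B := fun s => R * Real.exp s)
    (B' := fun s => R * Real.exp s) ht
    (fun s _ => (hd s).continuousAt.continuousWithinAt) (fun s _ => hd s)
    (fun s => (Real.hasDerivAt_exp s).const_mul R) (fun s _ => by
      rw [norm_smul, Real.norm_eq_abs, Real.abs_exp, mul_comm]
      gcongr
      exact hh s)
  have h2 : ‖Real.exp t • (u t - c)‖ ≤ R * Real.exp t := by
    have := norm_le_insert' (Real.exp t • (u t - c)) (Real.exp (0 : ℝ) • (u 0 - c))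
    simp only [Real.exp_zero, one_smul] at *
    linarith
  rw [norm_smul, Real.norm_eq_abs, Real.abs_exp, mul_comm] at h2
  exact le_of_mul_le_mul_right h2 (Real.exp_pos t)

end ODE

/-! ### Pointwise bounds in `L^∞`. -/

section Linfty

variable {Ω : Type*} [MeasurableSpace Ω] {μ : Measure Ω}

theorem linfty_ae_abs_le (f : Lp ℝ ∞ μ) : ∀ᵐ x ∂μ, |f x| ≤ ‖f‖ := by
  filter_upwards [ae_le_eLpNormEssSup (f := (f : Ω → ℝ)) (μ := μ)] with x hx
  rw [Lp.norm_def, eLpNorm_exponent_top, ← Real.norm_eq_abs, ← toReal_enorm]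
  exact ENNReal.toReal_mono (by simpa using Lp.eLpNorm_ne_top f) hx

theorem linfty_norm_le {f : Lp ℝ ∞ μ} {C : ℝ} (hC : 0 ≤ C) (h : ∀ᵐ x ∂μ, |f x| ≤ C) :
    ‖f‖ ≤ C := by
  rw [Lp.norm_def, eLpNorm_exponent_top]
  exact ENNReal.toReal_le_of_le_ofReal hC (eLpNormEssSup_le_of_ae_bound h)

/-- The constant function as an element of `L^∞`. -/
def linftyConst (μ : Measure Ω) (c : ℝ) : Lp ℝ ∞ μ :=
  MemLp.toLp (fun _ => c) (memLp_top_of_bound aestronglyMeasurable_const |c| (by simp))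

theorem linftyConst_ae (c : ℝ) : linftyConst μ c =ᵐ[μ] fun _ => c := MemLp.coeFn_toLp _

theorem linfty_norm_sub_const_le_iff {f : Lp ℝ ∞ μ} {c R : ℝ} (hR : 0 ≤ R) :
    ‖f - linftyConst μ c‖ ≤ R ↔ ∀ᵐ x ∂μ, |f x - c| ≤ R := by
  constructor
  · intro h
    filter_upwards [linfty_ae_abs_le (f - linftyConst μ c), Lp.coeFn_sub f (linftyConst μ c),
      linftyConst_ae (μ := μ) c] with x h1 h2 h3
    rw [h2, Pi.sub_apply, h3] at h1
    exact h1.trans h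
  · intro h
    refine linfty_norm_le hR ?_
    filter_upwards [h, Lp.coeFn_sub f (linftyConst μ c),
      linftyConst_ae (μ := μ) c] with x h1 h2 h3
    rwa [h2, Pi.sub_apply, h3]

end Linfty

/-! ### The Vlasov equation in `L^∞`. -/

section VlasovEquation

open Set Metric
open scoped NNReal

variable {d : ℕ} {φ : Pos d → ℝ}

/-- The order interval `[0, e^{-α}]` is a closed ball about its midpoint, which makes the invariance
of balls applicable. -/
theorem mem_deltaPlus_iff {α : ℝ} {ϱ : Lp ℝ ∞ (volume : Measure (Pos d))} :
    ϱ ∈ DeltaPlus d α ↔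
      ‖ϱ - linftyConst volume (Real.exp (-α) / 2)‖ ≤ Real.exp (-α) / 2 := by
  rw [linfty_norm_sub_const_le_iff (by positivity)]
  constructor
  · rintro ⟨h1, h2⟩
    filter_upwards [h2, linfty_ae_abs_le ϱ] with x hx hx'
    rw [abs_le]
    rw [abs_of_nonneg hx] at hx'
    constructor <;> linarith
  · intro h
    refine ⟨linfty_norm_le (Real.exp_pos _).le ?_, ?_⟩
    · filter_upwards [h] with x hx
      rw [abs_le] at hx ⊢
      constructor <;> linarith [Real.exp_pos (-α)]
    · filter_upwards [h] with x hx
      rw [abs_le] at hx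
      linarith

/-- The convolution `φ ∗ ϱ`. -/
def conv (φ : Pos d → ℝ) (ϱ : Lp ℝ ∞ (volume : Measure (Pos d))) (x : Pos d) : ℝ :=
  ∫ y, φ (x - y) * ϱ y

theorem integrable_conv (hφ : Integrable φ) (ϱ : Lp ℝ ∞ (volume : Measure (Pos d))) (x : Pos d) :
    Integrable fun y => φ (x - y) * ϱ y :=
  (hφ.comp_sub_left x).mul_bdd (c := ‖ϱ‖) (Lp.aestronglyMeasurable ϱ) (linfty_ae_abs_le ϱ)

theorem aestronglyMeasurable_conv (hφ : Integrable φ)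
    (ϱ : Lp ℝ ∞ (volume : Measure (Pos d))) : AEStronglyMeasurable (conv φ ϱ) volume := by
  have h : AEStronglyMeasurable (fun p : Pos d × Pos d => φ (p.1 - p.2) * ϱ p.2)
      (volume.prod volume) := by
    have := (Lp.aestronglyMeasurable ϱ).convolution_integrand
      (ContinuousLinearMap.mul ℝ ℝ) hφ.aestronglyMeasurable
    simpa [mul_comm] using this
  exact h.integral_prod_right'

theorem abs_conv_le (hφ : Integrable φ) (ϱ : Lp ℝ ∞ (volume : Measure (Pos d)))
    (x : Pos d) : |conv φ ϱ x| ≤ (∫ y, |φ y|) * ‖ϱ‖ := by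
  have h : ‖∫ y, φ (x - y) * ϱ y‖ ≤ ∫ y, |φ (x - y)| * ‖ϱ‖ := by
    refine norm_integral_le_of_norm_le ((hφ.comp_sub_left x).abs.mul_const _) ?_
    filter_upwards [linfty_ae_abs_le ϱ] with y hy
    rw [norm_mul, Real.norm_eq_abs, Real.norm_eq_abs]
    gcongr
  rwa [integral_mul_const, integral_sub_left_eq_self (fun y => |φ y|) volume x] at h

theorem conv_sub (hφ : Integrable φ) (ϱ σ : Lp ℝ ∞ (volume : Measure (Pos d))) (x : Pos d) :
    conv φ (ϱ - σ) x = conv φ ϱ x - conv φ σ x := by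
  rw [conv, conv, conv, ← integral_sub (integrable_conv hφ ϱ x) (integrable_conv hφ σ x)]
  refine integral_congr_ae ?_
  filter_upwards [Lp.coeFn_sub ϱ σ] with y hy
  rw [hy, Pi.sub_apply, mul_sub]

theorem conv_nonneg (hφ : ∀ x, 0 ≤ φ x) {ϱ : Lp ℝ ∞ (volume : Measure (Pos d))}
    (hϱ : ∀ᵐ x, 0 ≤ ϱ x) (x : Pos d) : 0 ≤ conv φ ϱ x := by
  refine integral_nonneg_of_ae ?_
  filter_upwards [hϱ] with y hy using mul_nonneg (hφ _) hy

/-- Composition of the convolution with a continuous locally bounded function. -/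
theorem memLp_comp_conv (hφ : Integrable φ) {g : ℝ → ℝ} (hg : Continuous g)
    (ϱ : Lp ℝ ∞ (volume : Measure (Pos d))) :
    MemLp (fun x => g (conv φ ϱ x)) ∞ volume := by
  obtain ⟨C, hC⟩ := (isCompact_closedBall (0 : ℝ) ((∫ y, |φ y|) * ‖ϱ‖)).exists_bound_of_continuousOn
    hg.continuousOn
  refine memLp_top_of_bound (hg.comp_aestronglyMeasurable (aestronglyMeasurable_conv hφ ϱ)) C ?_
  refine Eventually.of_forall fun x => hC _ ?_
  rw [mem_closedBall_zero_iff]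
  exact abs_conv_le hφ ϱ x

/-- The element `g ∘ (φ ∗ ϱ)` of `L^∞`. -/
def compConv (hφ : Integrable φ) {g : ℝ → ℝ} (hg : Continuous g)
    (ϱ : Lp ℝ ∞ (volume : Measure (Pos d))) : Lp ℝ ∞ (volume : Measure (Pos d)) :=
  (memLp_comp_conv hφ hg ϱ).toLp

theorem compConv_ae (hφ : Integrable φ) {g : ℝ → ℝ} (hg : Continuous g)
    (ϱ : Lp ℝ ∞ (volume : Measure (Pos d))) :
    compConv hφ hg ϱ =ᵐ[volume] fun x => g (conv φ ϱ x) := MemLp.coeFn_toLp _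

/-- The set `t` lets one estimate serve both the truncated nonlinearity, with `t = univ`, and the
exponential itself, which is Lipschitz only on half-lines bounded below. -/
theorem lipschitzOnWith_compConv (hφ : Integrable φ) {g : ℝ → ℝ} (hg : Continuous g)
    {s : Set (Lp ℝ ∞ (volume : Measure (Pos d)))} {t : Set ℝ} {L : ℝ≥0}
    (hs : ∀ ϱ ∈ s, ∀ x, conv φ ϱ x ∈ t) (hL : LipschitzOnWith L g t) :
    LipschitzOnWith (L * Real.toNNReal (∫ y, |φ y|)) (compConv hφ hg) s := by
  refine LipschitzOnWith.of_dist_le_mul fun ϱ hϱ σ hσ => ?_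
  have hI : 0 ≤ ∫ y, |φ y| := integral_nonneg fun _ => abs_nonneg _
  rw [dist_eq_norm, dist_eq_norm]
  refine linfty_norm_le (by positivity) ?_
  filter_upwards [Lp.coeFn_sub (compConv hφ hg ϱ) (compConv hφ hg σ), compConv_ae hφ hg ϱ,
    compConv_ae hφ hg σ] with x h1 h2 h3
  rw [h1, Pi.sub_apply, h2, h3]
  have h4 := hL.dist_le_mul _ (hs ϱ hϱ x) _ (hs σ hσ x)
  rw [Real.dist_eq, Real.dist_eq, ← conv_sub hφ] at h4
  refine h4.trans ?_
  rw [NNReal.coe_mul, Real.coe_toNNReal _ hI, mul_assoc]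
  gcongr
  exact abs_conv_le hφ _ x

theorem lipschitzOnWith_exp_neg (ϰ : ℝ) (r : ℝ) :
    LipschitzOnWith (Real.toNNReal (|ϰ| * Real.exp (-r))) (fun a => ϰ * Real.exp (-a)) (Ici r) := by
  refine Convex.lipschitzOnWith_of_nnnorm_hasDerivWithin_le (f' := fun a => ϰ * -Real.exp (-a))
    (convex_Ici r) (fun a _ => ?_) fun a ha => ?_
  · simpa using (((hasDerivAt_neg a).exp).const_mul ϰ).hasDerivWithinAt
  · rw [← NNReal.coe_le_coe, coe_nnnorm, Real.coe_toNNReal _ (by positivity), norm_mul, norm_neg,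
      Real.norm_eq_abs, Real.norm_eq_abs, Real.abs_exp]
    gcongr
    exact ha

theorem continuous_exp_neg (ϰ : ℝ) : Continuous fun a : ℝ => ϰ * Real.exp (-a) := by fun_prop

theorem continuous_exp_neg_max (ϰ : ℝ) : Continuous fun a : ℝ => ϰ * Real.exp (-max 0 a) := by
  fun_prop

/-- Global existence for the Vlasov equation, with values in the invariant set `DeltaPlus`. -/
theorem exists_solution_vlasovEq (hφ_nonneg : ∀ x, 0 ≤ φ x) (hφ : Integrable φ)
    {ϰ α₀ : ℝ} (hϰ : 0 < ϰ) (hϰα₀ : ϰ ≤ Real.exp (-α₀))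
    {ϱ₀ : Lp ℝ ∞ (volume : Measure (Pos d))} (hϱ₀ : ϱ₀ ∈ DeltaPlus d α₀) :
    ∃ ϱ : ℝ → Lp ℝ ∞ (volume : Measure (Pos d)),
      ϱ 0 = ϱ₀ ∧ Differentiable ℝ ϱ ∧ Continuous (deriv ϱ) ∧
      (∀ t, 0 ≤ t → ϱ t ∈ DeltaPlus d α₀) ∧
      (∀ t, 0 ≤ t → VlasovEqGraph φ ϰ (ϱ t) (deriv ϱ t)) := by
  -- The positive part keeps the exponent nonpositive, so `H` is bounded by `ϰ` and globally
  -- Lipschitz.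
  set H := compConv hφ (continuous_exp_neg_max ϰ) with hHdef
  have hHae : ∀ ϱ, ∀ᵐ x, 0 ≤ H ϱ x ∧ H ϱ x ≤ ϰ := by
    intro ϱ
    filter_upwards [compConv_ae hφ (continuous_exp_neg_max ϰ) ϱ] with x hx
    rw [hHdef, hx]
    refine ⟨by positivity, mul_le_of_le_one_right hϰ.le ?_⟩
    rw [Real.exp_le_one_iff]
    simp
  have hHbd : ∀ ϱ, ‖H ϱ‖ ≤ ϰ := by
    intro ϱ
    refine linfty_norm_le hϰ.le ?_
    filter_upwards [hHae ϱ] with x hx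
    rw [abs_of_nonneg hx.1]
    exact hx.2
  obtain ⟨K, hHlip⟩ : ∃ K, LipschitzWith K H := by
    refine ⟨_, lipschitzOnWith_univ.1 (lipschitzOnWith_compConv hφ (continuous_exp_neg_max ϰ)
      (t := univ) (by simp) (L := Real.toNNReal (|ϰ| * Real.exp (-0)) * 1) ?_)⟩
    refine (lipschitzOnWith_exp_neg ϰ 0).comp (g := fun a => ϰ * Real.exp (-a))
      (f := fun a => max 0 a) ?_ fun a _ => by simp
    exact (LipschitzWith.id.const_max 0).lipschitzOnWith
  obtain ⟨ϱ, h0, hder⟩ := exists_forall_hasDerivAt_neg_add hHlip hHbd ϱ₀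
  have hcont : Continuous ϱ :=
    continuous_iff_continuousAt.2 fun t => (hder t).continuousAt
  have hderiv : deriv ϱ = fun t => -(ϱ t) + H (ϱ t) := funext fun t => (hder t).deriv
  have hdelta : ∀ t, 0 ≤ t → ϱ t ∈ DeltaPlus d α₀ := by
    intro t ht
    rw [mem_deltaPlus_iff]
    refine norm_sub_le_of_hasDerivAt_neg_add hder (fun s => ?_) ?_ ht
    · rw [linfty_norm_sub_const_le_iff (by positivity)]
      filter_upwards [hHae (ϱ s)] with x hx
      rw [abs_le]
      constructor <;> linarith
    · rw [h0]
      exact mem_deltaPlus_iff.1 hϱ₀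
  refine ⟨ϱ, h0, fun t => (hder t).differentiableAt, ?_, hdelta, fun t ht => ?_⟩
  · rw [hderiv]
    exact hcont.neg.add (hHlip.continuous.comp hcont)
  · rw [hderiv]
    unfold VlasovEqGraph
    filter_upwards [Lp.coeFn_add (-(ϱ t)) (H (ϱ t)), Lp.coeFn_neg (ϱ t),
      compConv_ae hφ (continuous_exp_neg_max ϰ) (ϱ t)] with x h1 h2 h3
    rw [h1, Pi.add_apply, h2, Pi.neg_apply, hHdef, h3,
      max_eq_right (conv_nonneg hφ_nonneg (hdelta t ht).2 x)]
    rfl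

theorem vlasovEq_unique (hφ : Integrable φ) {ϰ : ℝ}
    {f g : ℝ → Lp ℝ ∞ (volume : Measure (Pos d))} {b : ℝ}
    (hf : ContinuousOn f (Icc 0 b))
    (hf' : ∀ t ∈ Ioo 0 b, DifferentiableAt ℝ f t ∧ VlasovEqGraph φ ϰ (f t) (deriv f t))
    (hg : ContinuousOn g (Icc 0 b))
    (hg' : ∀ t ∈ Ioo 0 b, DifferentiableAt ℝ g t ∧ VlasovEqGraph φ ϰ (g t) (deriv g t))
    (h0 : f 0 = g 0) : EqOn f g (Icc 0 b) := by
  have graph : ∀ ϱ σ : Lp ℝ ∞ (volume : Measure (Pos d)), VlasovEqGraph φ ϰ ϱ σ →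
      σ = -ϱ + compConv hφ (continuous_exp_neg ϰ) ϱ := by
    intro ϱ σ h
    refine Lp.ext ?_
    filter_upwards [h, Lp.coeFn_add (-ϱ) (compConv hφ (continuous_exp_neg ϰ) ϱ), Lp.coeFn_neg ϱ,
      compConv_ae hφ (continuous_exp_neg ϰ) ϱ] with x h1 h2 h3 h4
    rw [h1, h2, Pi.add_apply, h3, Pi.neg_apply, h4]
    rfl
  have eqn : ∀ u : ℝ → Lp ℝ ∞ (volume : Measure (Pos d)),
      (∀ t ∈ Ioo 0 b, DifferentiableAt ℝ u t ∧ VlasovEqGraph φ ϰ (u t) (deriv u t)) →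
      ∀ t ∈ Ioo 0 b, HasDerivAt u (-(u t) + compConv hφ (continuous_exp_neg ϰ) (u t)) t := by
    intro u hu t ht
    rw [← graph _ _ (hu t ht).2]
    exact (hu t ht).1.hasDerivAt
  refine eqOn_Icc_of_hasDerivAt_Ioo
    (G := fun ϱ => -ϱ + compConv hφ (continuous_exp_neg ϰ) ϱ) (fun R => ?_) hf (eqn f hf') hg
    (eqn g hg') h0
  -- A competing solution need not be nonnegative. On the ball of radius `R` the convolution is
  -- still at least `-(∫ |φ|) R`, which bounds the slope of the exponential.
  refine ⟨_, LipschitzWith.id.neg.lipschitzOnWith.add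
    (lipschitzOnWith_compConv hφ (continuous_exp_neg ϰ) (t := Ici (-((∫ y, |φ y|) * R)))
      (fun ϱ hϱ x => ?_) (lipschitzOnWith_exp_neg ϰ _))⟩
  rw [mem_closedBall_zero_iff] at hϱ
  have h1 := (abs_le.1 (abs_conv_le hφ ϱ x)).1
  have h2 : (∫ y, |φ y|) * ‖ϱ‖ ≤ (∫ y, |φ y|) * R :=
    mul_le_mul_of_nonneg_left hϱ (integral_nonneg fun _ => abs_nonneg _)
  exact (neg_le_neg h2).trans h1

end VlasovEquation

/-! ### Null sets and measurability on configuration space. -/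

section Configurations

open Set

variable {d : ℕ}

theorem nontrivial_pos (hd : 1 ≤ d) : Nontrivial (Pos d) := by
  have : Nonempty (Fin d) := ⟨⟨0, hd⟩⟩
  infer_instance

theorem measurable_conf_iff {β : Type*} [MeasurableSpace β] {f : Conf d → β} :
    Measurable f ↔ ∀ n, Measurable fun x : DistinctTuple d n => f (toConf d n x) := by
  constructor
  · exact fun h n A hA => measurableSet_conf_iff.1 (h hA) n
  · exact fun h A hA => measurableSet_conf_iff.2 fun n => h n hA

theorem measurable_toConf (n : ℕ) : Measurable (toConf d n) := fun _ hA =>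
  measurableSet_conf_iff.1 hA n

open scoped Classical in
/-- The configuration of the entries of a tuple, which need not be distinct. -/
def tupleConf {ι : Type*} [Fintype ι] (x : ι → Pos d) : Conf d := ⟨Finset.univ.image x⟩

open scoped Classical in
/-- The configuration of the entries of a tuple if these are distinct, and `∅` otherwise. -/
def injConf {ι : Type*} [Fintype ι] (x : ι → Pos d) : Conf d :=
  if Function.Injective x then tupleConf x else ⟨∅⟩

variable {ι : Type*} [Fintype ι]

theorem injConf_of_injective {x : ι → Pos d} (h : Function.Injective x) :
    injConf x = tupleConf x := if_pos h

theorem toConf_eq (n : ℕ) (x : DistinctTuple d n) : toConf d n x = tupleConf x.1 := by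
  classical
  ext y
  simp [toConf, tupleConf]

theorem measurableSet_injective : MeasurableSet {x : ι → Pos d | Function.Injective x} := by
  have : {x : ι → Pos d | Function.Injective x} =
      ⋂ i : ι, ⋂ j : ι, ⋂ (_ : i ≠ j), {x : ι → Pos d | x i = x j}ᶜ := by
    ext x
    simp only [mem_ofPred_eq, mem_iInter, mem_compl_iff, Function.Injective]
    exact forall₂_congr fun i j => not_imp_not.symm
  rw [this]
  refine MeasurableSet.iInter fun i => MeasurableSet.iInter fun j => MeasurableSet.iInter fun _ => ?_
  exact (measurableSet_eq_fun (measurable_pi_apply i) (measurable_pi_apply j)).compl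

/-- Each coincidence `x i = x j` defines a proper linear subspace, hence a null set; properness is
where `d ≥ 1` enters. -/
theorem ae_injective [Nontrivial (Pos d)] : ∀ᵐ x : ι → Pos d, Function.Injective x := by
  classical
  have key : ∀ i j : ι, i ≠ j → ∀ᵐ x : ι → Pos d, x i ≠ x j := by
    intro i j hij
    set S : Submodule ℝ (ι → Pos d) :=
      LinearMap.ker ((LinearMap.proj i : (ι → Pos d) →ₗ[ℝ] Pos d) - LinearMap.proj j) with hS
    have hmem : ∀ x, x ∈ S ↔ x i = x j := by
      intro x
      simp [hS, sub_eq_zero]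
    have hne : S ≠ ⊤ := by
      intro h
      obtain ⟨v, hv⟩ := exists_ne (0 : Pos d)
      have h1 : Pi.single i v ∈ S := h ▸ Submodule.mem_top
      rw [hmem, Pi.single_eq_same, Pi.single_eq_of_ne hij.symm] at h1
      exact hv h1
    have h0 := Measure.addHaar_submodule (volume : Measure (ι → Pos d)) S hne
    rw [ae_iff]
    convert h0 using 2
    ext x
    simp [hmem]
  have h2 : ∀ᵐ x : ι → Pos d, ∀ i j : ι, i ≠ j → x i ≠ x j := by
    simp only [ae_all_iff]
    exact key
  filter_upwards [h2] with x hx i j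
  exact not_imp_not.1 (hx i j)

theorem measurable_injConf_fin (n : ℕ) : Measurable (injConf : (Fin n → Pos d) → Conf d) := by
  classical
  have hr : Measurable ({x : Fin n → Pos d | Function.Injective x}.domRestrict injConf) := by
    convert (measurable_toConf (d := d) n).comp
      (measurable_subtype_coe.subtype_mk (p := fun x : Fin n → Pos d => Function.Injective x)
        (h := fun x : {x : Fin n → Pos d | Function.Injective x} => x.2)) using 1
    funext x
    exact (injConf_of_injective x.2).trans (toConf_eq n ⟨x.1, x.2⟩).symm
  refine measurable_of_restrict_of_restrict_compl measurableSet_injective hr ?_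
  convert measurable_const (a := (⟨∅⟩ : Conf d)) using 1
  funext x
  exact if_neg x.2

theorem tupleConf_comp_equiv {ι' : Type*} [Fintype ι'] (e : ι' ≃ ι) (x : ι → Pos d) :
    tupleConf (x ∘ e) = tupleConf x := by
  classical
  ext y
  simp only [tupleConf, Finset.mem_image, Finset.mem_univ, true_and, Function.comp]
  exact (e.surjective.exists (p := fun a => x a = y)).symm

theorem measurable_injConf : Measurable (injConf : (ι → Pos d) → Conf d) := by
  have e := Fintype.equivFin ι
  have h : Measurable fun x : ι → Pos d => injConf (x ∘ e.symm) :=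
    (measurable_injConf_fin _).comp (measurable_pi_lambda _ fun i => measurable_pi_apply _)
  convert h using 2 with x
  unfold injConf
  rw [tupleConf_comp_equiv]
  exact if_congr (Function.Injective.of_comp_iff' x e.symm.bijective).symm rfl rfl

theorem injConf_ae [Nontrivial (Pos d)] :
    (injConf : (ι → Pos d) → Conf d) =ᵐ[volume] tupleConf := by
  filter_upwards [ae_injective] with x hx using injConf_of_injective hx

/-- Discarding the null set of non-injective tuples replaces the subtype by the full product space,
where Fubini and product integrals apply. -/
theorem lebesguePoisson_eq [Nontrivial (Pos d)] :
    lebesguePoisson d = Measure.sum fun n : ℕ =>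
      ((n.factorial : ℝ≥0∞)⁻¹) • Measure.map injConf (volume : Measure (Fin n → Pos d)) := by
  unfold lebesguePoisson
  congr 1
  funext n
  congr 1
  ext A hA
  have hemb : MeasurableEmbedding (fun x : DistinctTuple d n => x.1) :=
    MeasurableEmbedding.subtype_coe measurableSet_injective
  rw [Measure.map_apply (measurable_toConf n) hA, hemb.comap_apply,
    Measure.map_apply measurable_injConf hA]
  refine measure_congr ?_
  filter_upwards [ae_injective (ι := Fin n) (d := d)] with x hx
  refine propext ⟨?_, fun h => ⟨⟨x, hx⟩, ?_, rfl⟩⟩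
  · rintro ⟨y, hy, rfl⟩
    change injConf y.1 ∈ A
    rwa [injConf_of_injective y.2, ← toConf_eq]
  · change injConf x ∈ A at h
    rwa [injConf_of_injective hx, ← toConf_eq n ⟨x, hx⟩] at h

theorem ae_tuple_fin [Nontrivial (Pos d)] {P : Conf d → Prop} (h : ∀ᵐ η ∂(lebesguePoisson d), P η)
    (n : ℕ) : ∀ᵐ x : Fin n → Pos d, P (tupleConf x) := by
  rw [lebesguePoisson_eq, Measure.ae_sum_iff] at h
  have h1 := h n
  rw [Measure.ae_ennreal_smul_measure_iff (by simp)] at h1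
  filter_upwards [ae_of_ae_map measurable_injConf.aemeasurable h1, injConf_ae] with x h1 h2
  rwa [← h2]

theorem ae_tuple [Nontrivial (Pos d)] {P : Conf d → Prop} (h : ∀ᵐ η ∂(lebesguePoisson d), P η) :
    ∀ᵐ x : ι → Pos d, P (tupleConf x) := by
  have e := Fintype.equivFin ι
  have h1 := (volume_measurePreserving_piCongrLeft (fun _ : ι => Pos d)
    e.symm).symm.quasiMeasurePreserving.ae (ae_tuple_fin h (Fintype.card ι))
  filter_upwards [h1] with x hx
  rw [← tupleConf_comp_equiv e.symm x]
  exact hx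

theorem exists_perm_of_tupleConf_eq {x y : ι → Pos d} (hx : Function.Injective x)
    (hy : Function.Injective y) (h : tupleConf x = tupleConf y) :
    ∃ σ : Equiv.Perm ι, y = x ∘ σ := by
  classical
  have hr : range y = range x := by
    have := congrArg (fun η : Conf d => (η.pts : Set (Pos d))) h
    simpa [tupleConf] using this.symm
  refine ⟨((Equiv.ofInjective y hy).trans (Equiv.setCongr hr)).trans
    (Equiv.ofInjective x hx).symm, ?_⟩
  funext i
  simp only [Function.comp, Equiv.trans_apply, Equiv.apply_ofInjective_symm hx]
  rfl

/-- A property of configurations which holds for almost all tuples holds almost everywhere; no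
measurability is needed. -/
theorem ae_of_forall_tuple [Nontrivial (Pos d)] {P : Conf d → Prop}
    (h : ∀ n, ∀ᵐ x : Fin n → Pos d, P (tupleConf x)) : ∀ᵐ η ∂(lebesguePoisson d), P η := by
  rw [lebesguePoisson_eq, Measure.ae_sum_iff]
  intro n
  rw [Measure.ae_ennreal_smul_measure_iff (by simp)]
  -- A measurable hull need not be permutation invariant. Its symmetrization `M` is, and is still
  -- null, so its image `B` in configuration space is measurable.
  set N := toMeasurable volume {x : Fin n → Pos d | ¬ P (tupleConf x)} with hN
  have hN0 : volume N = 0 := by rw [hN, measure_toMeasurable]; exact h n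
  have hcomp : ∀ σ : Equiv.Perm (Fin n), MeasurePreserving (fun x : Fin n → Pos d => x ∘ σ) :=
    fun σ => (volume_measurePreserving_piCongrLeft (fun _ : Fin n => Pos d) σ).symm
  set M : Set (Fin n → Pos d) := ⋃ σ : Equiv.Perm (Fin n), (fun x => x ∘ σ) ⁻¹' N with hM
  have hMm : MeasurableSet M := MeasurableSet.iUnion fun σ =>
    (hcomp σ).measurable (measurableSet_toMeasurable _ _)
  have hM0 : volume M = 0 := measure_iUnion_null fun σ =>
    (hcomp σ).quasiMeasurePreserving.preimage_null hN0
  set B : Set (Conf d) := {η | ∃ x : Fin n → Pos d, Function.Injective x ∧ x ∈ M ∧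
    tupleConf x = η} with hB
  have hcard : ∀ m (x : Fin m → Pos d), Function.Injective x → (tupleConf x).pts.card = m := by
    classical
    intro m x hx
    simp [tupleConf, Finset.card_image_of_injective _ hx]
  have hBm : MeasurableSet B := by
    rw [measurableSet_conf_iff]
    intro m
    by_cases hm : m = n
    · subst hm
      have : toConf d m ⁻¹' B = (fun x : DistinctTuple d m => x.1) ⁻¹' M := by
        ext x
        rw [mem_preimage, toConf_eq]
        constructor
        · rintro ⟨y, hy, hyM, hyx⟩
          obtain ⟨τ, hτ⟩ := exists_perm_of_tupleConf_eq x.2 hy hyx.symm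
          obtain ⟨σ, hσ⟩ := mem_iUnion.1 hyM
          refine mem_iUnion.2 ⟨σ.trans τ, ?_⟩
          rw [hτ] at hσ
          exact hσ
        · exact fun hx => ⟨x.1, x.2, hx, rfl⟩
      rw [this]
      exact measurable_subtype_coe hMm
    · convert MeasurableSet.empty
      rw [eq_empty_iff_forall_notMem]
      rintro x ⟨y, hy, -, hyx⟩
      rw [toConf_eq] at hyx
      have := congrArg (fun η : Conf d => η.pts.card) hyx
      simp only [hcard _ _ hy, hcard _ _ x.2] at this
      exact hm this.symm
  have hCm : MeasurableSet {η : Conf d | η.card = n} := by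
    rw [measurableSet_conf_iff]
    intro m
    by_cases hm : m = n
    · convert MeasurableSet.univ
      ext x
      simp [toConf, Conf.card, hm]
    · convert MeasurableSet.empty
      ext x
      simp [toConf, Conf.card, hm]
  have h1 : ∀ᵐ η ∂(Measure.map injConf (volume : Measure (Fin n → Pos d))), η ∉ B := by
    rw [ae_map_iff measurable_injConf.aemeasurable hBm.compl]
    have hM' : ∀ᵐ x, x ∉ M := measure_eq_zero_iff_ae_notMem.1 hM0
    filter_upwards [ae_injective (d := d) (ι := Fin n), hM'] with x hx hxM
    rw [injConf_of_injective hx]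
    rintro ⟨y, hy, hyM, hyx⟩
    obtain ⟨τ, hτ⟩ := exists_perm_of_tupleConf_eq hx hy hyx.symm
    obtain ⟨σ, hσ⟩ := mem_iUnion.1 hyM
    refine hxM (mem_iUnion.2 ⟨σ.trans τ, ?_⟩)
    rw [hτ] at hσ
    exact hσ
  have h2 : ∀ᵐ η ∂(Measure.map injConf (volume : Measure (Fin n → Pos d))), η.card = n := by
    rw [ae_map_iff measurable_injConf.aemeasurable hCm]
    filter_upwards [ae_injective (d := d) (ι := Fin n)] with x hx
    rw [injConf_of_injective hx]
    exact hcard _ _ hx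
  filter_upwards [h1, h2] with η hη hc
  by_contra hP
  let x : Fin n → Pos d := fun i => (η.pts.equivFinOfCardEq hc).symm i
  have hxi : Function.Injective x := Subtype.val_injective.comp (Equiv.injective _)
  have hxη : tupleConf x = η := by
    classical
    ext y
    simp only [tupleConf, Finset.mem_image, Finset.mem_univ, true_and]
    constructor
    · rintro ⟨i, rfl⟩
      exact ((η.pts.equivFinOfCardEq hc).symm i).2
    · intro hy
      exact ⟨η.pts.equivFinOfCardEq hc ⟨y, hy⟩, by simp [x]⟩
  refine hη ⟨x, hxi, mem_iUnion.2 ⟨1, ?_⟩, hxη⟩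
  exact subset_toMeasurable _ _ (by simpa [hxη] using hP)

theorem ae_forall_mem [Nontrivial (Pos d)] {P : Pos d → Prop} (h : ∀ᵐ x, P x) :
    ∀ᵐ η ∂(lebesguePoisson d), ∀ x ∈ η.pts, P x := by
  classical
  refine ae_of_forall_tuple fun n => ?_
  have : ∀ᵐ x : Fin n → Pos d, ∀ i, P (x i) :=
    ae_all_iff.2 fun i => (Measure.quasiMeasurePreserving_eval (fun _ => volume) i).ae h
  filter_upwards [this] with x hx y hy
  simp only [tupleConf, Finset.mem_image, Finset.mem_univ, true_and] at hy
  obtain ⟨i, rfl⟩ := hy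
  exact hx i

theorem ae_disjoint [Nontrivial (Pos d)] (s : Finset (Pos d)) :
    ∀ᵐ ξ ∂(lebesguePoisson d), Disjoint s ξ.pts := by
  have h : ∀ᵐ x : Pos d, x ∉ (s : Set (Pos d)) :=
    measure_eq_zero_iff_ae_notMem.1 (s.finite_toSet.measure_zero _)
  filter_upwards [ae_forall_mem h] with ξ hξ
  rw [Finset.disjoint_right]
  exact fun x hx => hξ x hx

/-- Null sets are not seen by `(η, ξ) ↦ (η \ x) ∪ ξ`. -/
theorem ae_replace [Nontrivial (Pos d)] {P : Conf d → Prop}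
    (h : ∀ᵐ η ∂(lebesguePoisson d), P η) :
    ∀ᵐ η ∂(lebesguePoisson d), ∀ x ∈ η.pts, ∀ᵐ ξ ∂(lebesguePoisson d), P (η.replace x ξ) := by
  classical
  refine ae_of_forall_tuple fun n => ?_
  -- Without its `i`-th entry, `x` joined with `y` is a generic tuple indexed by a disjoint sum, so
  -- Fubini applies; the condition does not involve `x i`.
  have key : ∀ i : Fin n, ∀ᵐ x : Fin n → Pos d, ∀ m : ℕ, ∀ᵐ y : Fin m → Pos d,
      P (tupleConf (Sum.elim (fun j : {j // j ≠ i} => x j) y)) := by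
    intro i
    rw [ae_all_iff]
    intro m
    have h1 : ∀ᵐ z : ({j // j ≠ i} ⊕ Fin m) → Pos d, P (tupleConf z) := ae_tuple h
    have h2 := (volume_measurePreserving_sumPiEquivProdPi_symm
      (fun _ : {j // j ≠ i} ⊕ Fin m => Pos d)).quasiMeasurePreserving.ae h1
    have h3 := Measure.ae_ae_of_ae_prod h2
    have h4 := (volume_preserving_piEquivPiSubtypeProd (fun _ : Fin n => Pos d)
      (fun j => j ≠ i)).quasiMeasurePreserving.ae (Measure.quasiMeasurePreserving_fst.ae h3)
    filter_upwards [h4] with x hx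
    filter_upwards [hx] with y hy
    convert hy using 2
    funext s
    rcases s with s | s <;> rfl
  filter_upwards [ae_all_iff.2 key, ae_injective (d := d) (ι := Fin n)] with x hx hinj z hz
  simp only [tupleConf, Finset.mem_image, Finset.mem_univ, true_and] at hz
  obtain ⟨i, rfl⟩ := hz
  refine ae_of_forall_tuple fun m => ?_
  filter_upwards [hx i m] with y hy
  convert hy using 1
  ext w
  simp only [Conf.replace, tupleConf, Finset.mem_union, Finset.mem_erase, Finset.mem_image,
    Finset.mem_univ, true_and, Sum.exists, Sum.elim_inl, Sum.elim_inr, Subtype.exists]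
  refine or_congr ⟨?_, ?_⟩ Iff.rfl
  · rintro ⟨hw, j, rfl⟩
    exact ⟨j, fun hj => hw (hj ▸ rfl), rfl⟩
  · rintro ⟨j, hj, rfl⟩
    exact ⟨fun h => hj (hinj h), j, rfl⟩

/-- For almost every `ξ` the union is disjoint. There it is the configuration of a concatenated
injective tuple, which depends measurably on `ξ`. -/
theorem aemeasurable_replace [Nontrivial (Pos d)] (η : Conf d) (x : Pos d) :
    AEMeasurable (fun ξ => η.replace x ξ) (lebesguePoisson d) := by
  classical
  set s := η.pts.erase x with hs
  refine ⟨fun ξ => if Disjoint s ξ.pts then ⟨s ∪ ξ.pts⟩ else ⟨∅⟩, ?_, ?_⟩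
  · rw [measurable_conf_iff]
    intro m
    have h1 : Measurable fun y : DistinctTuple d m =>
        injConf (Sum.elim (fun z : s => (z : Pos d)) y.1) := by
      refine measurable_injConf.comp (measurable_pi_lambda _ fun i => ?_)
      rcases i with i | i
      · exact measurable_const
      · exact (measurable_pi_apply i).comp measurable_subtype_coe
    convert h1 using 2 with y
    have hiff : Disjoint s (toConf d m y).pts ↔
        Function.Injective (Sum.elim (fun z : s => (z : Pos d)) y.1) := by
      rw [Sum.elim_injective]
      simp only [Subtype.val_injective, y.2, true_and, Finset.disjoint_right, toConf_eq, tupleConf,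
        Finset.mem_image, Finset.mem_univ, forall_exists_index, forall_apply_eq_imp_iff,
        Subtype.forall]
      exact ⟨fun h a ha b hab => h b (hab ▸ ha), fun h b hb => h _ hb b rfl⟩
    unfold injConf
    refine if_congr hiff ?_ rfl
    ext w
    simp [toConf_eq, tupleConf]
  · filter_upwards [ae_disjoint s] with ξ hξ
    rw [if_pos hξ, hs, Conf.replace]

end Configurations

/-! ### Integrals of Lebesgue–Poisson exponents. -/

section Exponents

variable {d : ℕ}

theorem lpExp_toConf (f : Pos d → ℝ) (n : ℕ) (x : DistinctTuple d n) :
    lpExp f (toConf d n x) = ∏ i, f (x.1 i) := by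
  simp [lpExp, toConf]

theorem measurable_lpExp {f : Pos d → ℝ} (hf : Measurable f) : Measurable (lpExp f) := by
  rw [measurable_conf_iff]
  intro n
  simp only [lpExp_toConf]
  exact Finset.measurable_prod _ fun i _ =>
    hf.comp ((measurable_pi_apply i).comp measurable_subtype_coe)

variable [Nontrivial (Pos d)]

theorem lpExp_congr_ae {f g : Pos d → ℝ} (h : f =ᵐ[volume] g) :
    lpExp f =ᵐ[lebesguePoisson d] lpExp g := by
  filter_upwards [ae_forall_mem h] with η hη
  exact Finset.prod_congr rfl hη

theorem aestronglyMeasurable_lpExp {f : Pos d → ℝ} (hf : AEStronglyMeasurable f volume) :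
    AEStronglyMeasurable (lpExp f) (lebesguePoisson d) :=
  ((measurable_lpExp hf.stronglyMeasurable_mk.measurable).aestronglyMeasurable).congr
    (lpExp_congr_ae hf.ae_eq_mk).symm

/-- On `n`-point configurations the integral factorizes into `(∫ f)^n / n!`, and these terms sum to
the exponential series. -/
theorem integrable_lpExp_and_integral_of_measurable {f : Pos d → ℝ} (hf : Integrable f)
    (hfm : Measurable f) :
    Integrable (lpExp f) (lebesguePoisson d) ∧
      ∫ ξ, lpExp f ξ ∂(lebesguePoisson d) = Real.exp (∫ x, f x) := by
  have hcomp : ∀ (g : Pos d → ℝ) (n : ℕ), (fun x : Fin n → Pos d => lpExp g (injConf x)) =ᵐ[volume]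
      fun x => ∏ i, g (x i) := by
    intro g n
    filter_upwards [ae_injective (ι := Fin n) (d := d)] with x hx
    rw [injConf_of_injective hx, ← toConf_eq n ⟨x, hx⟩, lpExp_toConf]
  have hint : ∀ {g : Pos d → ℝ}, Measurable g → ∀ n : ℕ,
      ∫ ξ, lpExp g ξ ∂(((n.factorial : ℝ≥0∞)⁻¹) •
        Measure.map injConf (volume : Measure (Fin n → Pos d))) =
        (∫ x, g x) ^ n / n.factorial := by
    intro g hg n
    rw [integral_smul_measure, integral_map measurable_injConf.aemeasurable
      (measurable_lpExp hg).aestronglyMeasurable, integral_congr_ae (hcomp g n),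
      integral_fin_nat_prod_volume_eq_prod]
    simp [div_eq_inv_mul]
  have hI : Integrable (lpExp f) (lebesguePoisson d) := by
    rw [lebesguePoisson_eq]
    refine integrable_sum_measure (fun n => ?_) ?_
    · refine Integrable.smul_measure ?_ (by simp [Nat.factorial_ne_zero])
      rw [integrable_map_measure (measurable_lpExp hfm).aestronglyMeasurable
        measurable_injConf.aemeasurable]
      exact (Integrable.fin_nat_prod (fun _ => hf)).congr (hcomp f n).symm
    · have habs : ∀ ξ : Conf d, ‖lpExp f ξ‖ = lpExp (fun x => |f x|) ξ := fun ξ => by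
        simp [lpExp]
      simp only [habs]
      simp only [hint hfm.abs]
      exact Real.summable_pow_div_factorial _
  refine ⟨hI, ?_⟩
  rw [lebesguePoisson_eq] at hI ⊢
  have h1 := hasSum_integral_measure hI
  simp only [hint hfm] at h1
  refine h1.unique ?_
  rw [Real.exp_eq_exp_ℝ]
  exact NormedSpace.expSeries_div_hasSum_exp (∫ x, f x)

theorem integrable_lpExp {f : Pos d → ℝ} (hf : Integrable f) :
    Integrable (lpExp f) (lebesguePoisson d) := by
  have h := hf.aestronglyMeasurable.ae_eq_mk
  exact (integrable_lpExp_and_integral_of_measurable (hf.congr h)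
    hf.aestronglyMeasurable.stronglyMeasurable_mk.measurable).1.congr (lpExp_congr_ae h).symm

theorem integral_lpExp {f : Pos d → ℝ} (hf : Integrable f) :
    ∫ ξ, lpExp f ξ ∂(lebesguePoisson d) = Real.exp (∫ x, f x) := by
  have h := hf.aestronglyMeasurable.ae_eq_mk
  rw [integral_congr_ae (lpExp_congr_ae h), integral_congr_ae h]
  exact (integrable_lpExp_and_integral_of_measurable (hf.congr h)
    hf.aestronglyMeasurable.stronglyMeasurable_mk.measurable).2

end Exponents

/-! ### Exponential weights in the number of points. -/

section Weights

variable {d : ℕ}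

theorem weight_pos (α : ℝ) (η : Conf d) : 0 < weight α η := Real.exp_pos _

theorem weight_mul_weight (α β : ℝ) (η : Conf d) :
    weight α η * weight β η = weight (α + β) η := by
  rw [weight, weight, weight, ← Real.exp_add, add_mul]

theorem weight_mono {α β : ℝ} (h : α ≤ β) (η : Conf d) : weight α η ≤ weight β η :=
  Real.exp_le_exp.2 (mul_le_mul_of_nonneg_right h (Nat.cast_nonneg _))

/-- This is the price `1 / δ` for absorbing a factor `|η|` when the weight exponent drops by `δ`. -/
theorem card_mul_weight_neg_le {δ : ℝ} (hδ : 0 < δ) (η : Conf d) :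
    (η.card : ℝ) * weight (-δ) η ≤ 1 / δ := by
  rw [weight, neg_mul, Real.exp_neg, le_div_iff₀ hδ, ← div_eq_mul_inv, div_mul_eq_mul_div,
    div_le_one (Real.exp_pos _)]
  linarith [Real.add_one_le_exp (δ * η.card)]

theorem card_sq_mul_weight_neg_le {δ : ℝ} (hδ : 0 < δ) (η : Conf d) :
    (η.card : ℝ) ^ 2 * weight (-δ) η ≤ 2 / δ ^ 2 := by
  rw [weight, neg_mul, Real.exp_neg, le_div_iff₀ (by positivity), ← div_eq_mul_inv,
    div_mul_eq_mul_div, div_le_iff₀ (Real.exp_pos _)]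
  have h0 : 0 ≤ δ * (η.card : ℝ) := by positivity
  nlinarith [Real.quadratic_le_exp_of_nonneg h0]

theorem card_replace {η ξ : Conf d} {x : Pos d} (hx : x ∈ η.pts)
    (h : Disjoint (η.pts.erase x) ξ.pts) :
    ((η.replace x ξ).card : ℝ) = η.card - 1 + ξ.card := by
  classical
  have h1 : (η.replace x ξ).card = (η.pts.erase x).card + ξ.pts.card := by
    rw [← Finset.card_union_of_disjoint h, Conf.card, Conf.replace]
  have h2 := Finset.card_erase_add_one hx
  rw [h1, Conf.card, Conf.card, ← h2]
  push_cast
  ring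

end Weights

/-! ### The scale of spaces `K_α` and its inclusions. -/

namespace KSpace

variable {d : ℕ} {α : ℝ}

theorem stronglyMeasurable_rep (k : KSpace d α) : StronglyMeasurable k.rep :=
  AEEqFun.stronglyMeasurable _

theorem rep_sub (a b : KSpace d α) : (a - b).rep =ᵐ[lebesguePoisson d] a.rep - b.rep :=
  AEEqFun.coeFn_sub (a.1 : Conf d →ₘ[lebesguePoisson d] ℝ) b.1

theorem ext_ae {a b : KSpace d α} (h : a.rep =ᵐ[lebesguePoisson d] b.rep) : a = b :=
  Subtype.ext (AEEqFun.ext h)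

theorem weight_mul_abs_rep_le (k : KSpace d α) :
    ∀ᵐ η ∂(lebesguePoisson d), weight α η * |k.rep η| ≤ ‖k‖ := by
  have h1 := linfty_ae_abs_le (MemLp.toLp _ k.memLp_rep)
  have h2 : ‖MemLp.toLp _ k.memLp_rep‖ = ‖k‖ := rfl
  filter_upwards [h1, MemLp.coeFn_toLp k.memLp_rep] with η h3 h4
  rw [h4, abs_mul, abs_of_pos (weight_pos _ _), h2] at h3
  exact h3

theorem norm_le_of_ae {k : KSpace d α} {C : ℝ} (hC : 0 ≤ C)
    (h : ∀ᵐ η ∂(lebesguePoisson d), weight α η * |k.rep η| ≤ C) : ‖k‖ ≤ C := by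
  change ‖MemLp.toLp _ k.memLp_rep‖ ≤ C
  refine linfty_norm_le hC ?_
  filter_upwards [h, MemLp.coeFn_toLp k.memLp_rep] with η h3 h4
  rwa [h4, abs_mul, abs_of_pos (weight_pos _ _)]

theorem memLp_weight_mul {f : Conf d → ℝ} (hf : AEStronglyMeasurable f (lebesguePoisson d)) {C : ℝ}
    (h : ∀ᵐ η ∂(lebesguePoisson d), weight α η * |f η| ≤ C) :
    MemLp (fun η => weight α η * f η) ∞ (lebesguePoisson d) := by
  refine memLp_top_of_bound ((measurable_weight α).aestronglyMeasurable.mul hf) C ?_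
  filter_upwards [h] with η hη
  rwa [norm_mul, Real.norm_eq_abs, Real.norm_eq_abs, abs_of_pos (weight_pos _ _)]

/-- The class of a function which is bounded by a multiple of the inverse weight. -/
def mk (f : Conf d → ℝ) (hf : AEStronglyMeasurable f (lebesguePoisson d)) (C : ℝ)
    (h : ∀ᵐ η ∂(lebesguePoisson d), weight α η * |f η| ≤ C) : KSpace d α :=
  ⟨AEEqFun.mk f hf, by
    refine (memLp_weight_mul hf h).ae_eq ?_
    filter_upwards [AEEqFun.coeFn_mk f hf] with η hη
    rw [hη]⟩

theorem mk_rep (f : Conf d → ℝ) (hf : AEStronglyMeasurable f (lebesguePoisson d)) (C : ℝ)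
    (h : ∀ᵐ η ∂(lebesguePoisson d), weight α η * |f η| ≤ C) :
    (mk f hf C h).rep =ᵐ[lebesguePoisson d] f := AEEqFun.coeFn_mk f hf

theorem weight_mul_abs_rep_le_of_le {β : ℝ} (h : β ≤ α) (k : KSpace d α) :
    ∀ᵐ η ∂(lebesguePoisson d), weight β η * |k.rep η| ≤ ‖k‖ := by
  filter_upwards [k.weight_mul_abs_rep_le] with η hη
  exact (mul_le_mul_of_nonneg_right (weight_mono h η) (abs_nonneg _)).trans hη

theorem kSubmodule_mono {β : ℝ} (h : β ≤ α) : kSubmodule d α ≤ kSubmodule d β := fun k hk =>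
  memLp_weight_mul (AEEqFun.stronglyMeasurable k).aestronglyMeasurable
    (weight_mul_abs_rep_le_of_le h (⟨k, hk⟩ : KSpace d α))

/-- The inclusion of `K_α` into `K_β` for `β ≤ α`, as a linear map. -/
def inclLinear {β : ℝ} (h : β ≤ α) : KSpace d α →ₗ[ℝ] KSpace d β :=
  Submodule.inclusion (kSubmodule_mono h)

theorem rep_inclLinear {β : ℝ} (h : β ≤ α) (k : KSpace d α) : (inclLinear h k).rep = k.rep := by
  have h1 : (inclLinear h k).1 = k.1 := Submodule.coe_inclusion (kSubmodule_mono h) k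
  unfold rep
  rw [h1]

theorem norm_inclLinear_le {β : ℝ} (h : β ≤ α) (k : KSpace d α) : ‖inclLinear h k‖ ≤ ‖k‖ := by
  refine norm_le_of_ae (norm_nonneg _) ?_
  rw [rep_inclLinear]
  exact k.weight_mul_abs_rep_le_of_le h

/-- The inclusion of `K_α` into `K_β` for `β ≤ α`. -/
def incl {β : ℝ} (h : β ≤ α) : KSpace d α →L[ℝ] KSpace d β :=
  (inclLinear h).mkContinuous 1 fun k => (norm_inclLinear_le h k).trans_eq (one_mul _).symm

theorem rep_incl {β : ℝ} (h : β ≤ α) (k : KSpace d α) : (incl h k).rep = k.rep := by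
  rw [incl, LinearMap.mkContinuous_apply, rep_inclLinear]

theorem norm_incl_le {β : ℝ} (h : β ≤ α) (k : KSpace d α) : ‖incl h k‖ ≤ ‖k‖ := by
  rw [incl, LinearMap.mkContinuous_apply]
  exact norm_inclLinear_le h k

theorem incl_injective {β : ℝ} (h : β ≤ α) : Function.Injective (incl (d := d) h) := by
  intro a b hab
  refine ext_ae ?_
  rw [← rep_incl h a, ← rep_incl h b, hab]

end KSpace

/-! ### The Vlasov operator on the scale, and uniqueness for the hierarchy. -/

section Operator

open Set

variable {d : ℕ} [Nontrivial (Pos d)] {φ : Pos d → ℝ}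

/-- The integrals in the Vlasov operator converge absolutely on `K_γ`. -/
theorem integrable_and_abs_integral_replace_le (hφ_nonneg : ∀ x, 0 ≤ φ x) (hφ : Integrable φ)
    {γ : ℝ} (k : KSpace d γ) :
    ∀ᵐ η ∂(lebesguePoisson d), ∀ x ∈ η.pts,
      Integrable (fun ξ => lpExp (fun y => -φ (x - y)) ξ * k.rep (η.replace x ξ))
        (lebesguePoisson d) ∧
      |∫ ξ, lpExp (fun y => -φ (x - y)) ξ * k.rep (η.replace x ξ) ∂(lebesguePoisson d)| ≤
        ‖k‖ * (Real.exp γ * Real.exp (Real.exp (-γ) * ∫ y, φ y)) * weight (-γ) η := by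
  classical
  filter_upwards [ae_replace k.weight_mul_abs_rep_le] with η hη x hx
  have hint : Integrable fun y => Real.exp (-γ) * φ (x - y) := (hφ.comp_sub_left x).const_mul _
  -- The configuration `(η \ x) ∪ ξ` has `|η| - 1 + |ξ|` points almost surely. The removed point
  -- yields `e^γ`, and each point of `ξ` contributes `e^{-γ}` to the majorant.
  set c : ℝ := ‖k‖ * Real.exp γ * weight (-γ) η with hc
  have hmaj : Integrable (fun ξ => c * lpExp (fun y => Real.exp (-γ) * φ (x - y)) ξ)
      (lebesguePoisson d) := (integrable_lpExp hint).const_mul _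
  have hle : ∀ᵐ ξ ∂(lebesguePoisson d),
      ‖lpExp (fun y => -φ (x - y)) ξ * k.rep (η.replace x ξ)‖ ≤
        c * lpExp (fun y => Real.exp (-γ) * φ (x - y)) ξ := by
    filter_upwards [hη x hx, ae_disjoint (η.pts.erase x)] with ξ h1 h2
    have h3 : |lpExp (fun y => -φ (x - y)) ξ| = lpExp (fun y => φ (x - y)) ξ := by
      simp [lpExp, Finset.abs_prod, abs_of_nonneg (hφ_nonneg _)]
    have h4 : lpExp (fun y => Real.exp (-γ) * φ (x - y)) ξ =
        Real.exp (-γ * ξ.card) * lpExp (fun y => φ (x - y)) ξ := by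
      rw [lpExp, Finset.prod_mul_distrib, Finset.prod_const, ← Real.exp_nat_mul, mul_comm (-γ)]
      rfl
    have h5 : |k.rep (η.replace x ξ)| ≤ c * Real.exp (-γ * ξ.card) := by
      rw [mul_comm, ← le_div_iff₀ (weight_pos _ _)] at h1
      refine h1.trans_eq ?_
      rw [hc, weight, weight, card_replace hx h2, mul_assoc, mul_assoc, ← Real.exp_add,
        ← Real.exp_add, div_eq_mul_inv, ← Real.exp_neg]
      congr 2
      ring
    rw [norm_mul, Real.norm_eq_abs, Real.norm_eq_abs, h3, h4]
    have h6 : 0 ≤ lpExp (fun y => φ (x - y)) ξ := h3 ▸ abs_nonneg _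
    calc lpExp (fun y => φ (x - y)) ξ * |k.rep (η.replace x ξ)|
        ≤ lpExp (fun y => φ (x - y)) ξ * (c * Real.exp (-γ * ξ.card)) := by gcongr
      _ = c * (Real.exp (-γ * ξ.card) * lpExp (fun y => φ (x - y)) ξ) := by ring
  have hmeas : AEStronglyMeasurable
      (fun ξ => lpExp (fun y => -φ (x - y)) ξ * k.rep (η.replace x ξ)) (lebesguePoisson d) :=
    (aestronglyMeasurable_lpExp (hφ.comp_sub_left x).neg.aestronglyMeasurable).mul
      (k.stronglyMeasurable_rep.measurable.comp_aemeasurable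
        (aemeasurable_replace η x)).aestronglyMeasurable
  refine ⟨hmaj.mono' hmeas hle, ?_⟩
  refine (norm_integral_le_of_norm_le hmaj hle).trans_eq ?_
  rw [integral_const_mul, integral_lpExp hint, integral_const_mul,
    integral_sub_left_eq_self φ volume x, hc]
  ring

/-- The bound `C / (γ - β)` for the norm of the Vlasov operator from `K_γ` to `K_β`, with a constant
which is uniform for `γ` in `[α - 1, α]`. -/
theorem norm_le_of_vlasovOp (hφ_nonneg : ∀ x, 0 ≤ φ x) (hφ : Integrable φ) {ϰ : ℝ} (hϰ : 0 ≤ ϰ)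
    {α β γ : ℝ} (hβγ : β < γ) (hγα : γ ≤ α) (hαγ : α - 1 ≤ γ) (k : KSpace d γ) (g : KSpace d β)
    (hg : g.rep =ᵐ[lebesguePoisson d] vlasovOp φ ϰ k.rep) :
    ‖g‖ ≤ (1 + ϰ * (Real.exp α * Real.exp (Real.exp (1 - α) * ∫ y, φ y))) / (γ - β) * ‖k‖ := by
  have hδ : 0 < γ - β := sub_pos.2 hβγ
  set C₀ : ℝ := Real.exp α * Real.exp (Real.exp (1 - α) * ∫ y, φ y) with hC₀
  have hC₀pos : 0 < C₀ := by positivity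
  have hC₀le : Real.exp γ * Real.exp (Real.exp (-γ) * ∫ y, φ y) ≤ C₀ := by
    have h0 : 0 ≤ ∫ y, φ y := integral_nonneg hφ_nonneg
    have h1 : Real.exp (-γ) ≤ Real.exp (1 - α) := Real.exp_le_exp.2 (by linarith)
    rw [hC₀]
    gcongr
  refine KSpace.norm_le_of_ae (by positivity) ?_
  filter_upwards [hg, k.weight_mul_abs_rep_le,
    integrable_and_abs_integral_replace_le hφ_nonneg hφ k] with η h1 h2 h3
  have h4 : |k.rep η| ≤ ‖k‖ * weight (-γ) η := by
    calc |k.rep η| = (weight γ η * |k.rep η|) * weight (-γ) η := by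
          rw [mul_right_comm, weight_mul_weight]
          simp [weight]
      _ ≤ _ := mul_le_mul_of_nonneg_right h2 (weight_pos _ _).le
  have h5 : |∑ x ∈ η.pts, ∫ ξ, lpExp (fun y => -φ (x - y)) ξ * k.rep (η.replace x ξ)
      ∂(lebesguePoisson d)| ≤ η.card * (‖k‖ * C₀ * weight (-γ) η) := by
    refine (Finset.abs_sum_le_sum_abs _ _).trans ?_
    rw [Conf.card, ← nsmul_eq_mul]
    refine Finset.sum_le_card_nsmul _ _ _ fun x hx => (h3 x hx).2.trans ?_
    exact mul_le_mul_of_nonneg_right (mul_le_mul_of_nonneg_left hC₀le (norm_nonneg _))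
      (weight_pos _ _).le
  have h6 : |g.rep η| ≤ (1 + ϰ * C₀) * ‖k‖ * (η.card * weight (-γ) η) := by
    rw [h1, vlasovOp]
    refine (abs_add_le _ _).trans ?_
    rw [abs_mul, abs_mul, abs_neg, Nat.abs_cast, abs_of_nonneg hϰ]
    have h7 := mul_le_mul_of_nonneg_left h4 (Nat.cast_nonneg (α := ℝ) η.card)
    have h8 := mul_le_mul_of_nonneg_left h5 hϰ
    linarith
  calc weight β η * |g.rep η|
      ≤ weight β η * ((1 + ϰ * C₀) * ‖k‖ * (η.card * weight (-γ) η)) :=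
        mul_le_mul_of_nonneg_left h6 (weight_pos _ _).le
    _ = (1 + ϰ * C₀) * ‖k‖ * (η.card * (weight β η * weight (-γ) η)) := by ring
    _ = (1 + ϰ * C₀) * ‖k‖ * (η.card * weight (-(γ - β)) η) := by
        rw [weight_mul_weight]
        congr 4
        ring
    _ ≤ (1 + ϰ * C₀) * ‖k‖ * (1 / (γ - β)) := by
        have := card_mul_weight_neg_le hδ η
        gcongr
    _ = (1 + ϰ * C₀) / (γ - β) * ‖k‖ := by ring

theorem VlasovGraph.sub (hφ_nonneg : ∀ x, 0 ≤ φ x) (hφ : Integrable φ) {ϰ α : ℝ}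
    {k₁ g₁ k₂ g₂ : KSpace d α} (h₁ : VlasovGraph φ ϰ α k₁ g₁) (h₂ : VlasovGraph φ ϰ α k₂ g₂) :
    VlasovGraph φ ϰ α (k₁ - k₂) (g₁ - g₂) := by
  refine ⟨?_, ?_⟩
  · filter_upwards [integrable_and_abs_integral_replace_le hφ_nonneg hφ (k₁ - k₂)] with η h x hx
    exact (h x hx).1
  -- Representatives are additive only almost everywhere, and the integrals evaluate them at `(η \
  -- x) ∪ ξ`; hence `ae_replace`.
  · filter_upwards [KSpace.rep_sub k₁ k₂, KSpace.rep_sub g₁ g₂, ae_replace (KSpace.rep_sub k₁ k₂),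
      h₁.1, h₁.2, h₂.1, h₂.2] with η e1 e2 e3 i1 e4 i2 e5
    have e6 : ∀ x ∈ η.pts,
        ∫ ξ, lpExp (fun y => -φ (x - y)) ξ * (k₁ - k₂).rep (η.replace x ξ) ∂(lebesguePoisson d) =
        ∫ ξ, lpExp (fun y => -φ (x - y)) ξ * k₁.rep (η.replace x ξ) ∂(lebesguePoisson d) -
        ∫ ξ, lpExp (fun y => -φ (x - y)) ξ * k₂.rep (η.replace x ξ) ∂(lebesguePoisson d) := by
      intro x hx
      rw [← integral_sub (i1 x hx) (i2 x hx)]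
      refine integral_congr_ae ?_
      filter_upwards [e3 x hx] with ξ hξ
      rw [hξ, Pi.sub_apply, mul_sub]
    rw [e2, Pi.sub_apply, e4, e5, vlasovOp, vlasovOp, vlasovOp, Finset.sum_congr rfl e6,
      Finset.sum_sub_distrib, e1, Pi.sub_apply]
    ring

/-- A solution of the Vlasov hierarchy which vanishes at the beginning of a short interval vanishes
on the whole interval: an estimate along the scale of spaces between `K_α` and `K_{α - 1}`. -/
theorem eq_zero_of_vlasovGraph_of_short (hφ_nonneg : ∀ x, 0 ≤ φ x) (hφ : Integrable φ)
    {ϰ α : ℝ} (hϰ : 0 ≤ ϰ) {w w' : ℝ → KSpace d α} {a b : ℝ}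
    (hw : ContinuousOn w (Icc a b)) (hw' : ∀ t ∈ Ioo a b, HasDerivAt w (w' t) t)
    (hgraph : ∀ t ∈ Ioo a b, VlasovGraph φ ϰ α (w t) (w' t)) (ha : w a = 0)
    (hshort : (1 + ϰ * (Real.exp α * Real.exp (Real.exp (1 - α) * ∫ y, φ y))) * Real.exp 1 *
      (b - a) < 1) :
    ∀ t ∈ Icc a b, w t = 0 := by
  set C : ℝ := 1 + ϰ * (Real.exp α * Real.exp (Real.exp (1 - α) * ∫ y, φ y)) with hC
  have hCpos : 0 < C := by positivity
  obtain ⟨M, hM⟩ := isCompact_Icc.exists_bound_of_continuousOn hw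
  intro t ht
  have hM0 : 0 ≤ M := (norm_nonneg _).trans (hM t ht)
  -- Each descent by `1 / N` costs a factor `C N` from the operator bound and gains one integration
  -- in time.
  have scale : ∀ N : ℕ, 0 < N → ∀ j : ℕ, j ≤ N → ∀ β : ℝ, β = α - j / N → ∀ h : β ≤ α,
      ∀ t ∈ Icc a b, ‖KSpace.incl h (w t)‖ ≤ M * (C * N) ^ j * ((t - a) ^ j / j.factorial) := by
    intro N hN j
    have hN' : (0 : ℝ) < N := by exact_mod_cast hN
    induction j with
    | zero =>
      intro _ β _ h t ht
      simpa using (KSpace.norm_incl_le h (w t)).trans (hM t ht)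
    | succ j ih =>
      intro hj β hβ h t ht
      have hj' : (j : ℝ) + 1 ≤ N := by exact_mod_cast hj
      have hjN : (j : ℝ) / N ≤ 1 := (div_le_one hN').2 (by linarith)
      have hj0 : 0 ≤ (j : ℝ) / N := by positivity
      set γ : ℝ := α - j / N with hγ
      have hγα : γ ≤ α := by linarith
      have hγβ : γ - β = 1 / N := by
        rw [hγ, hβ]
        push_cast
        ring
      have hβγ : β < γ := by
        have : 0 < 1 / (N : ℝ) := by positivity
        linarith
      have hpow : ∀ s : ℝ, HasDerivAt (fun s => M * (C * N) ^ (j + 1) *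
          ((s - a) ^ (j + 1) / (j + 1).factorial))
          (M * (C * N) ^ (j + 1) * ((s - a) ^ j / j.factorial)) s := by
        intro s
        have h1 := ((((hasDerivAt_id s).sub_const a).pow (j + 1)).div_const
          ((j + 1).factorial : ℝ)).const_mul (M * (C * N) ^ (j + 1))
        refine h1.congr_deriv ?_
        rw [Nat.factorial_succ]
        push_cast
        simp only [id, mul_one]
        have : (j.factorial : ℝ) ≠ 0 := by positivity
        field_simp
      have hmv := norm_sub_le_of_norm_deriv_le_Ioo (f := fun s => KSpace.incl h (w s))
        (f' := fun s => KSpace.incl h (w' s)) ht.1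
        ((KSpace.incl h).continuous.comp_continuousOn (hw.mono (Icc_subset_Icc_right ht.2)))
        (fun s hs => (KSpace.incl h).hasFDerivAt.comp_hasDerivAt s
          (hw' s ⟨hs.1, hs.2.trans_le ht.2⟩)) hpow (fun s hs => ?_)
      · simpa [ha] using hmv
      · have hs' : s ∈ Icc a b := ⟨hs.1.le, hs.2.le.trans ht.2⟩
        have h1 := ih (by omega) γ hγ hγα s hs'
        have h2 := norm_le_of_vlasovOp hφ_nonneg hφ hϰ hβγ hγα (by linarith)
          (KSpace.incl hγα (w s)) (KSpace.incl h (w' s))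
          (by
            rw [KSpace.rep_incl, KSpace.rep_incl]
            exact (hgraph s ⟨hs.1, hs.2.trans_le ht.2⟩).2)
        rw [hγβ, ← hC, one_div, div_inv_eq_mul] at h2
        refine h2.trans ((mul_le_mul_of_nonneg_left h1 (by positivity)).trans_eq ?_)
        ring
  have h1 : α - 1 ≤ α := by linarith
  have hbound : ∀ N : ℕ, 0 < N →
      ‖KSpace.incl h1 (w t)‖ ≤ M * (C * Real.exp 1 * (t - a)) ^ N := by
    intro N hN
    have hN' : (N : ℝ) ≠ 0 := by exact_mod_cast hN.ne'
    refine (scale N hN N le_rfl (α - 1) (by rw [div_self hN']) h1 t ht).trans ?_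
    -- The bound `N^N / N! ≤ e^N` turns the iterated estimate into a geometric sequence.
    have h2 := Real.pow_div_factorial_le_exp (N : ℝ) (Nat.cast_nonneg _) N
    have h3 : 0 ≤ t - a := sub_nonneg.2 ht.1
    calc M * (C * N) ^ N * ((t - a) ^ N / N.factorial)
        = M * (C * (t - a)) ^ N * ((N : ℝ) ^ N / N.factorial) := by
          rw [mul_pow, mul_pow]
          ring
      _ ≤ M * (C * (t - a)) ^ N * Real.exp N := by gcongr
      _ = M * (C * Real.exp 1 * (t - a)) ^ N := by
          rw [← Real.exp_one_pow, mul_assoc M, ← mul_pow]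
          ring_nf
  have hq0 : 0 ≤ C * Real.exp 1 * (t - a) :=
    mul_nonneg (by positivity) (sub_nonneg.2 ht.1)
  have hq1 : C * Real.exp 1 * (t - a) < 1 := by
    refine lt_of_le_of_lt (mul_le_mul_of_nonneg_left ?_ (by positivity)) hshort
    linarith [ht.2]
  have hlim : Tendsto (fun N : ℕ => M * (C * Real.exp 1 * (t - a)) ^ N) atTop (𝓝 0) := by
    simpa using (tendsto_pow_atTop_nhds_zero_of_lt_one hq0 hq1).const_mul M
  have hzero : ‖KSpace.incl h1 (w t)‖ ≤ 0 := by
    refine ge_of_tendsto hlim ?_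
    filter_upwards [eventually_gt_atTop 0] with N hN using hbound N hN
  refine KSpace.incl_injective h1 ?_
  rw [map_zero]
  exact norm_le_zero_iff.1 hzero

theorem eq_zero_of_vlasovGraph (hφ_nonneg : ∀ x, 0 ≤ φ x) (hφ : Integrable φ)
    {ϰ α : ℝ} (hϰ : 0 ≤ ϰ) {w w' : ℝ → KSpace d α} {b : ℝ}
    (hw : ContinuousOn w (Icc 0 b)) (hw' : ∀ t ∈ Ioo 0 b, HasDerivAt w (w' t) t)
    (hgraph : ∀ t ∈ Ioo 0 b, VlasovGraph φ ϰ α (w t) (w' t)) (h0 : w 0 = 0) :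
    ∀ t ∈ Icc 0 b, w t = 0 := by
  set C : ℝ := 1 + ϰ * (Real.exp α * Real.exp (Real.exp (1 - α) * ∫ y, φ y)) with hC
  have hCpos : 0 < C := by positivity
  -- Half of the critical length `1 / (C e)`. It is independent of the starting time, so finitely
  -- many steps reach any `t`.
  set τ : ℝ := (2 * (C * Real.exp 1))⁻¹ with hτ
  have hτpos : 0 < τ := by positivity
  have hτC : C * Real.exp 1 * τ < 1 := by
    have : C * Real.exp 1 * τ = 1 / 2 := by
      rw [hτ]
      field_simp
    rw [this]
    norm_num
  have step : ∀ n : ℕ, ∀ t ∈ Icc 0 b, t ≤ n * τ → w t = 0 := by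
    intro n
    induction n with
    | zero =>
      intro t ht htn
      have : t = 0 := le_antisymm (by simpa using htn) ht.1
      rw [this, h0]
    | succ n ih =>
      intro t ht htn
      rcases le_or_gt t (n * τ) with h | h
      · exact ih t ht h
      have ha : (0 : ℝ) ≤ n * τ := by positivity
      refine eq_zero_of_vlasovGraph_of_short hφ_nonneg hφ hϰ (a := n * τ) (b := t)
        (hw.mono (Icc_subset_Icc ha ht.2))
        (fun s hs => hw' s ⟨ha.trans_lt hs.1, hs.2.trans_le ht.2⟩)
        (fun s hs => hgraph s ⟨ha.trans_lt hs.1, hs.2.trans_le ht.2⟩)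
        (ih _ ⟨ha, h.le.trans ht.2⟩ le_rfl) ?_ t (right_mem_Icc.2 h.le)
      refine lt_of_le_of_lt (mul_le_mul_of_nonneg_left ?_ (by positivity)) hτC
      push_cast at htn
      linarith
  intro t ht
  obtain ⟨n, hn⟩ := exists_nat_ge (t / τ)
  exact step n t ht ((div_le_iff₀ hτpos).1 hn)

end Operator

/-! ### Finite products: first and second order estimates. -/

section Products

open Finset

variable {ι : Type*} {f g c c' : ι → ℝ} {B δ ε h M : ℝ}

theorem abs_prod_le (s : Finset ι) (hf : ∀ x ∈ s, |f x| ≤ B) : |∏ x ∈ s, f x| ≤ B ^ #s := by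
  rw [abs_prod]
  exact (prod_le_prod (fun _ _ => abs_nonneg _) hf).trans_eq (prod_const B)

variable [DecidableEq ι]

/-- The derivative of the product `∏ x ∈ s, g x` in the direction `c`. -/
def prodDeriv (s : Finset ι) (g c : ι → ℝ) : ℝ := ∑ x ∈ s, c x * ∏ y ∈ s.erase x, g y

theorem prodDeriv_insert {s : Finset ι} {a : ι} (ha : a ∉ s) (g c : ι → ℝ) :
    prodDeriv (insert a s) g c = c a * ∏ y ∈ s, g y + g a * prodDeriv s g c := by
  rw [prodDeriv, sum_insert ha, erase_insert ha, prodDeriv, mul_sum]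
  congr 1
  refine sum_congr rfl fun x hx => ?_
  have hxa : a ≠ x := fun h => ha (h ▸ hx)
  rw [erase_insert_of_ne hxa, prod_insert fun h => ha (mem_of_mem_erase h)]
  ring

/-- Factors are exchanged one at a time. The factor `B` on the left avoids the exponent `#s - 1` on
the right. -/
theorem abs_prod_sub_prod_le (hB : 0 ≤ B) (hδ : 0 ≤ δ) (s : Finset ι) (hf : ∀ x ∈ s, |f x| ≤ B)
    (hg : ∀ x ∈ s, |g x| ≤ B) (hfg : ∀ x ∈ s, |f x - g x| ≤ δ) :
    B * |∏ x ∈ s, f x - ∏ x ∈ s, g x| ≤ #s * δ * B ^ #s := by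
  induction s using Finset.induction_on with
  | empty => simp
  | insert a s ha ih =>
    simp only [forall_mem_insert] at hf hg hfg
    rw [prod_insert ha, prod_insert ha, card_insert_of_notMem ha]
    have e : f a * ∏ x ∈ s, f x - g a * ∏ x ∈ s, g x =
        (f a - g a) * ∏ x ∈ s, f x + g a * (∏ x ∈ s, f x - ∏ x ∈ s, g x) := by ring
    rw [e]
    have h1 := ih hf.2 hg.2 hfg.2
    have h2 : |f a - g a| * |∏ x ∈ s, f x| ≤ δ * B ^ #s :=
      mul_le_mul hfg.1 (abs_prod_le s hf.2) (abs_nonneg _) hδ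
    have h3 : |g a| * (B * |∏ x ∈ s, f x - ∏ x ∈ s, g x|) ≤ B * (#s * δ * B ^ #s) :=
      mul_le_mul hg.1 h1 (by positivity) hB
    have h4 := abs_add_le ((f a - g a) * ∏ x ∈ s, f x) (g a * (∏ x ∈ s, f x - ∏ x ∈ s, g x))
    rw [abs_mul, abs_mul] at h4
    have h5 := mul_le_mul_of_nonneg_left h4 hB
    have h6 := mul_le_mul_of_nonneg_left h2 hB
    push_cast
    rw [pow_succ B #s]
    linarith

/-- Pairs of increments account for the term `δ ^ 2`, and the linearization error of each single
factor for the term `ε`. The count `#s ^ 2` of pairs is generous, which closes the induction. -/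
theorem abs_prod_sub_prod_sub_prodDeriv_le (hB : 0 ≤ B) (hδ : 0 ≤ δ) (hε : 0 ≤ ε) (s : Finset ι)
    (hf : ∀ x ∈ s, |f x| ≤ B) (hg : ∀ x ∈ s, |g x| ≤ B) (hfg : ∀ x ∈ s, |f x - g x| ≤ δ)
    (hc : ∀ x ∈ s, |f x - g x - h * c x| ≤ ε) :
    B ^ 2 * |∏ x ∈ s, f x - ∏ x ∈ s, g x - h * prodDeriv s g c| ≤
      ((#s : ℝ) ^ 2 * δ ^ 2 + #s * ε * B) * B ^ #s := by
  induction s using Finset.induction_on with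
  | empty => simp [prodDeriv]
  | insert a s ha ih =>
    simp only [forall_mem_insert] at hf hg hfg hc
    rw [prod_insert ha, prod_insert ha, card_insert_of_notMem ha, prodDeriv_insert ha]
    set F := ∏ x ∈ s, f x
    set G := ∏ x ∈ s, g x
    set R := F - G - h * prodDeriv s g c
    have e : f a * F - g a * G - h * (c a * G + g a * prodDeriv s g c) =
        g a * R + (f a - g a) * (F - G) + (f a - g a - h * c a) * G := by
      simp only [R]
      ring
    rw [e]
    have h1 := ih hf.2 hg.2 hfg.2 hc.2
    have h2 : |g a| * (B ^ 2 * |R|) ≤ B * (((#s : ℝ) ^ 2 * δ ^ 2 + #s * ε * B) * B ^ #s) :=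
      mul_le_mul hg.1 h1 (by positivity) hB
    have h3 : |f a - g a| * (B * |F - G|) ≤ δ * (#s * δ * B ^ #s) :=
      mul_le_mul hfg.1 (abs_prod_sub_prod_le hB hδ s hf.2 hg.2 hfg.2) (by positivity) hδ
    have h4 : |f a - g a - h * c a| * |G| ≤ ε * B ^ #s :=
      mul_le_mul hc.1 (abs_prod_le s hg.2) (abs_nonneg _) hε
    have h5 : |g a * R + (f a - g a) * (F - G) + (f a - g a - h * c a) * G| ≤
        |g a| * |R| + |f a - g a| * |F - G| + |f a - g a - h * c a| * |G| := by
      rw [← abs_mul, ← abs_mul, ← abs_mul]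
      exact abs_add_three _ _ _
    have h6 := mul_le_mul_of_nonneg_left h5 (sq_nonneg B)
    have h7 := mul_le_mul_of_nonneg_left h3 hB
    have h8 := mul_le_mul_of_nonneg_left h4 (sq_nonneg B)
    have h9 : 0 ≤ ((#s : ℝ) + 1) * δ ^ 2 * (B ^ #s * B) := by positivity
    push_cast
    rw [pow_succ B #s]
    linarith

theorem abs_prodDeriv_sub_le (hB : 0 ≤ B) (hδ : 0 ≤ δ) (hε : 0 ≤ ε) (hM : 0 ≤ M) (s : Finset ι)
    (hf : ∀ x ∈ s, |f x| ≤ B) (hg : ∀ x ∈ s, |g x| ≤ B) (hfg : ∀ x ∈ s, |f x - g x| ≤ δ)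
    (hc : ∀ x ∈ s, |c x - c' x| ≤ ε) (hc' : ∀ x ∈ s, |c' x| ≤ M) :
    B ^ 2 * |prodDeriv s f c - prodDeriv s g c'| ≤
      ((#s : ℝ) ^ 2 * (M * δ) + #s * ε * B) * B ^ #s := by
  have key : ∀ x ∈ s, B ^ 2 * |c x * ∏ y ∈ s.erase x, f y - c' x * ∏ y ∈ s.erase x, g y| ≤
      (#s * (M * δ) + ε * B) * B ^ #s := by
    intro x hx
    set F := ∏ y ∈ s.erase x, f y
    set G := ∏ y ∈ s.erase x, g y
    have hsub : ∀ {p : ι → Prop}, (∀ y ∈ s, p y) → ∀ y ∈ s.erase x, p y :=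
      fun h y hy => h y (mem_of_mem_erase hy)
    have hcard : #(s.erase x) + 1 = #s := card_erase_add_one hx
    have hB1 : B * B ^ #(s.erase x) = B ^ #s := by rw [← hcard, pow_succ, mul_comm]
    have h1 : B * |F - G| ≤ #(s.erase x) * δ * B ^ #(s.erase x) :=
      abs_prod_sub_prod_le hB hδ _ (hsub hf) (hsub hg) (hsub hfg)
    have h2 : |F| ≤ B ^ #(s.erase x) := abs_prod_le _ (hsub hf)
    have h3 : |c x - c' x| * |F| ≤ ε * B ^ #(s.erase x) :=
      mul_le_mul (hc x hx) h2 (abs_nonneg _) hε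
    have h4 : |c' x| * (B * |F - G|) ≤ M * (#(s.erase x) * δ * B ^ #(s.erase x)) :=
      mul_le_mul (hc' x hx) h1 (by positivity) hM
    have e : c x * F - c' x * G = (c x - c' x) * F + c' x * (F - G) := by ring
    have h5 : |c x * F - c' x * G| ≤ |c x - c' x| * |F| + |c' x| * |F - G| := by
      rw [e, ← abs_mul, ← abs_mul]
      exact abs_add_le _ _
    have h6 := mul_le_mul_of_nonneg_left h5 (sq_nonneg B)
    have h7 := mul_le_mul_of_nonneg_left h3 (sq_nonneg B)
    have h8 := mul_le_mul_of_nonneg_left h4 hB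
    have hcard' : (#(s.erase x) : ℝ) ≤ #s := by exact_mod_cast (by omega)
    have h9 : (#(s.erase x) : ℝ) * (M * δ * B ^ #s) ≤ #s * (M * δ * B ^ #s) :=
      mul_le_mul_of_nonneg_right hcard' (by positivity)
    rw [← hB1] at h9 ⊢
    linarith
  rw [prodDeriv, prodDeriv, ← sum_sub_distrib]
  calc B ^ 2 * |∑ x ∈ s, (c x * ∏ y ∈ s.erase x, f y - c' x * ∏ y ∈ s.erase x, g y)|
      ≤ B ^ 2 * ∑ x ∈ s, |c x * ∏ y ∈ s.erase x, f y - c' x * ∏ y ∈ s.erase x, g y| := by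
        gcongr
        exact abs_sum_le_sum_abs _ _
    _ ≤ #s • ((#s * (M * δ) + ε * B) * B ^ #s) := by
        rw [mul_sum]
        exact sum_le_card_nsmul _ _ _ key
    _ = ((#s : ℝ) ^ 2 * (M * δ) + #s * ε * B) * B ^ #s := by
        rw [nsmul_eq_mul]
        ring

end Products

/-! ### The map `ϱ ↦ e(ϱ, ·)` into `K_α` and its derivative. -/

section ExponentialVectors

open Set

open scoped Classical in
/-- The directional derivative of the Lebesgue–Poisson exponent. -/
def lpExpDeriv {d : ℕ} (g c : Pos d → ℝ) (η : Conf d) : ℝ := prodDeriv η.pts g c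

variable {d : ℕ}

theorem measurable_lpExpDeriv {g c : Pos d → ℝ} (hg : Measurable g) (hc : Measurable c) :
    Measurable (lpExpDeriv g c) := by
  classical
  rw [measurable_conf_iff]
  intro n
  have h : ∀ x : DistinctTuple d n, lpExpDeriv g c (toConf d n x) =
      ∑ i, c (x.1 i) * ∏ j ∈ Finset.univ.erase i, g (x.1 j) := by
    intro x
    simp only [lpExpDeriv, prodDeriv, toConf, Finset.sum_map]
    refine Finset.sum_congr rfl fun i _ => ?_
    rw [← Finset.map_erase, Finset.prod_map]
    rfl
  simp only [h]
  have hm : ∀ {f : Pos d → ℝ}, Measurable f → ∀ i : Fin n,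
      Measurable fun x : DistinctTuple d n => f (x.1 i) :=
    fun hf i => hf.comp ((measurable_pi_apply i).comp measurable_subtype_coe)
  exact Finset.measurable_sum _ fun i _ =>
    (hm hc i).mul (Finset.measurable_prod _ fun j _ => hm hg j)

theorem measurable_linfty (ϱ : Lp ℝ ∞ (volume : Measure (Pos d))) : Measurable ϱ :=
  (Lp.stronglyMeasurable ϱ).measurable

variable {α α₀ : ℝ}

theorem weight_mul_exp_pow (η : Conf d) :
    weight α η * Real.exp (-α₀) ^ η.card = weight (-(α₀ - α)) η := by
  rw [weight, weight, ← Real.exp_nat_mul, ← Real.exp_add]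
  congr 1
  ring

/-- The weighted supremum estimate behind the differentiability of `ϱ ↦ e(ϱ, ·)`. -/
theorem weight_mul_le_of_quadratic_bound (hα : α < α₀) {η : Conf d} {v P Q : ℝ} (hP : 0 ≤ P)
    (hQ : 0 ≤ Q) (h : Real.exp (-α₀) ^ 2 * |v| ≤
      ((η.card : ℝ) ^ 2 * P + η.card * Q * Real.exp (-α₀)) * Real.exp (-α₀) ^ η.card) :
    weight α η * |v| ≤ (Real.exp α₀ ^ 2 * (2 / (α₀ - α) ^ 2)) * P +
      (Real.exp α₀ * (1 / (α₀ - α))) * Q := by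
  have hδ : 0 < α₀ - α := sub_pos.2 hα
  have hB : Real.exp α₀ * Real.exp (-α₀) = 1 := by rw [← Real.exp_add]; simp
  have h1 := card_mul_weight_neg_le hδ η
  have h2 := card_sq_mul_weight_neg_le hδ η
  have h3 : |v| = Real.exp α₀ ^ 2 * (Real.exp (-α₀) ^ 2 * |v|) := by
    rw [← mul_assoc, ← mul_pow, hB]
    ring
  calc weight α η * |v|
      ≤ weight α η * (Real.exp α₀ ^ 2 * (((η.card : ℝ) ^ 2 * P + η.card * Q * Real.exp (-α₀)) *
          Real.exp (-α₀) ^ η.card)) := by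
        rw [h3]
        have := (weight_pos α η).le
        gcongr
    _ = Real.exp α₀ ^ 2 * ((η.card : ℝ) ^ 2 * (weight α η * Real.exp (-α₀) ^ η.card)) * P +
        (Real.exp α₀ * Real.exp (-α₀)) * Real.exp α₀ *
          (η.card * (weight α η * Real.exp (-α₀) ^ η.card)) * Q := by ring
    _ ≤ Real.exp α₀ ^ 2 * (2 / (α₀ - α) ^ 2) * P + Real.exp α₀ * (1 / (α₀ - α)) * Q := by
        rw [weight_mul_exp_pow, hB, one_mul]
        gcongr

theorem weight_mul_abs_lpExp_le [Nontrivial (Pos d)] (hα : α < α₀)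
    {ϱ : Lp ℝ ∞ (volume : Measure (Pos d))} (hϱ : ϱ ∈ DeltaPlus d α₀) :
    ∀ᵐ η ∂(lebesguePoisson d), weight α η * |lpExp ϱ η| ≤ 1 := by
  filter_upwards [ae_forall_mem (linfty_ae_abs_le ϱ)] with η hη
  calc weight α η * |lpExp ϱ η| ≤ weight α η * Real.exp (-α₀) ^ η.card :=
        mul_le_mul_of_nonneg_left (abs_prod_le _ fun x hx => (hη x hx).trans hϱ.1)
          (weight_pos _ _).le
    _ = weight (-(α₀ - α)) η := weight_mul_exp_pow η
    _ ≤ weight 0 η := weight_mono (by linarith) η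
    _ = 1 := by simp [weight]

/-- The constant in the second order estimates for the exponential vectors. -/
def quadConst (α α₀ : ℝ) : ℝ := Real.exp α₀ ^ 2 * (2 / (α₀ - α) ^ 2)

/-- The constant in the first order estimates for the exponential vectors. -/
def linConst (α α₀ : ℝ) : ℝ := Real.exp α₀ * (1 / (α₀ - α))

theorem quadConst_nonneg : 0 ≤ quadConst α α₀ := by unfold quadConst; positivity

theorem linConst_nonneg (hα : α < α₀) : 0 ≤ linConst α α₀ := by
  have : 0 < α₀ - α := sub_pos.2 hα
  unfold linConst
  positivity

theorem ae_forall_mem_abs_sub_le [Nontrivial (Pos d)]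
    (ϱ σ : Lp ℝ ∞ (volume : Measure (Pos d))) :
    ∀ᵐ η ∂(lebesguePoisson d), ∀ x ∈ η.pts, |ϱ x - σ x| ≤ ‖ϱ - σ‖ := by
  refine ae_forall_mem ?_
  filter_upwards [linfty_ae_abs_le (ϱ - σ), Lp.coeFn_sub ϱ σ] with x h1 h2
  rwa [h2] at h1

theorem weight_mul_abs_lpExpDeriv_sub_le [Nontrivial (Pos d)] (hα : α < α₀)
    {ϱ σ : Lp ℝ ∞ (volume : Measure (Pos d))} (hϱ : ϱ ∈ DeltaPlus d α₀) (hσ : σ ∈ DeltaPlus d α₀)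
    (c c' : Lp ℝ ∞ (volume : Measure (Pos d))) :
    ∀ᵐ η ∂(lebesguePoisson d), weight α η * |lpExpDeriv ϱ c η - lpExpDeriv σ c' η| ≤
      quadConst α α₀ * (‖c'‖ * ‖ϱ - σ‖) + linConst α α₀ * ‖c - c'‖ := by
  classical
  filter_upwards [ae_forall_mem (linfty_ae_abs_le ϱ), ae_forall_mem (linfty_ae_abs_le σ),
    ae_forall_mem (linfty_ae_abs_le c'), ae_forall_mem_abs_sub_le ϱ σ,
    ae_forall_mem_abs_sub_le c c'] with η h1 h2 h3 h4 h5
  refine weight_mul_le_of_quadratic_bound hα (by positivity) (norm_nonneg _) ?_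
  exact abs_prodDeriv_sub_le (Real.exp_pos (-α₀)).le (norm_nonneg _) (norm_nonneg _)
    (norm_nonneg _) η.pts (fun x hx => (h1 x hx).trans hϱ.1) (fun x hx => (h2 x hx).trans hσ.1)
    h4 h5 h3

theorem weight_mul_abs_lpExpDeriv_le [Nontrivial (Pos d)] (hα : α < α₀)
    {ϱ : Lp ℝ ∞ (volume : Measure (Pos d))} (hϱ : ϱ ∈ DeltaPlus d α₀)
    (c : Lp ℝ ∞ (volume : Measure (Pos d))) :
    ∀ᵐ η ∂(lebesguePoisson d), weight α η * |lpExpDeriv ϱ c η| ≤ linConst α α₀ * ‖c‖ := by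
  filter_upwards [weight_mul_abs_lpExpDeriv_sub_le hα hϱ hϱ c 0,
    ae_forall_mem (Lp.coeFn_zero ℝ ∞ (volume : Measure (Pos d)))] with η h1 h2
  have h3 : lpExpDeriv ϱ (0 : Lp ℝ ∞ (volume : Measure (Pos d))) η = 0 :=
    Finset.sum_eq_zero fun x hx => by rw [h2 x hx, Pi.zero_apply, zero_mul]
  simpa only [h3, sub_zero, norm_zero, zero_mul, mul_zero, zero_add] using h1

theorem weight_mul_abs_lpExp_sub_le [Nontrivial (Pos d)] (hα : α < α₀)
    {ϱ σ : Lp ℝ ∞ (volume : Measure (Pos d))} (hϱ : ϱ ∈ DeltaPlus d α₀) (hσ : σ ∈ DeltaPlus d α₀)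
    (h : ℝ) (c : Lp ℝ ∞ (volume : Measure (Pos d))) :
    ∀ᵐ η ∂(lebesguePoisson d),
      weight α η * |lpExp ϱ η - lpExp σ η - h * lpExpDeriv σ c η| ≤
        quadConst α α₀ * ‖ϱ - σ‖ ^ 2 + linConst α α₀ * ‖ϱ - σ - h • c‖ := by
  classical
  have h0 : ∀ᵐ η ∂(lebesguePoisson d), ∀ x ∈ η.pts,
      |ϱ x - σ x - h * c x| ≤ ‖ϱ - σ - h • c‖ := by
    refine ae_forall_mem ?_
    filter_upwards [linfty_ae_abs_le (ϱ - σ - h • c), Lp.coeFn_sub (ϱ - σ) (h • c),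
      Lp.coeFn_sub ϱ σ, Lp.coeFn_smul h c] with x h1 h2 h3 h4
    rwa [h2, Pi.sub_apply, h3, Pi.sub_apply, h4] at h1
  filter_upwards [ae_forall_mem (linfty_ae_abs_le ϱ), ae_forall_mem (linfty_ae_abs_le σ),
    ae_forall_mem_abs_sub_le ϱ σ, h0] with η h1 h2 h4 h5
  refine weight_mul_le_of_quadratic_bound hα (by positivity) (norm_nonneg _) ?_
  exact abs_prod_sub_prod_sub_prodDeriv_le (Real.exp_pos (-α₀)).le (norm_nonneg _)
    (norm_nonneg _) η.pts (fun x hx => (h1 x hx).trans hϱ.1) (fun x hx => (h2 x hx).trans hσ.1)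
    h4 h5

variable [Nontrivial (Pos d)]

/-- The exponential vector `e(ϱ, ·)` as an element of `K_α`. -/
def expVec (hα : α < α₀) (ϱ : DeltaPlus d α₀) : KSpace d α :=
  KSpace.mk (lpExp ϱ.1) (measurable_lpExp (measurable_linfty ϱ.1)).aestronglyMeasurable 1
    (weight_mul_abs_lpExp_le hα ϱ.2)

theorem rep_expVec (hα : α < α₀) (ϱ : DeltaPlus d α₀) :
    (expVec hα ϱ).rep =ᵐ[lebesguePoisson d] lpExp ϱ.1 := KSpace.mk_rep _ _ _ _

/-- The derivative of `ϱ ↦ e(ϱ, ·)` in the direction `c`. -/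
def expVecDeriv (hα : α < α₀) (ϱ : DeltaPlus d α₀) (c : Lp ℝ ∞ (volume : Measure (Pos d))) :
    KSpace d α :=
  KSpace.mk (lpExpDeriv ϱ.1 c)
    (measurable_lpExpDeriv (measurable_linfty ϱ.1) (measurable_linfty c)).aestronglyMeasurable _
    (weight_mul_abs_lpExpDeriv_le hα ϱ.2 c)

theorem rep_expVecDeriv (hα : α < α₀) (ϱ : DeltaPlus d α₀)
    (c : Lp ℝ ∞ (volume : Measure (Pos d))) :
    (expVecDeriv hα ϱ c).rep =ᵐ[lebesguePoisson d] lpExpDeriv ϱ.1 c := KSpace.mk_rep _ _ _ _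

theorem norm_expVec_sub_le (hα : α < α₀) (ϱ σ : DeltaPlus d α₀) (h : ℝ)
    (c : Lp ℝ ∞ (volume : Measure (Pos d))) :
    ‖expVec hα ϱ - expVec hα σ - h • expVecDeriv hα σ c‖ ≤
      quadConst α α₀ * ‖ϱ.1 - σ.1‖ ^ 2 + linConst α α₀ * ‖ϱ.1 - σ.1 - h • c‖ := by
  have h1 := linConst_nonneg hα
  have h2 := quadConst_nonneg (α := α) (α₀ := α₀)
  refine KSpace.norm_le_of_ae (by positivity) ?_
  filter_upwards [weight_mul_abs_lpExp_sub_le hα ϱ.2 σ.2 h c, rep_expVec hα ϱ, rep_expVec hα σ,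
    rep_expVecDeriv hα σ c, KSpace.rep_sub (expVec hα ϱ - expVec hα σ) (h • expVecDeriv hα σ c),
    KSpace.rep_sub (expVec hα ϱ) (expVec hα σ), KSpace.rep_smul h (expVecDeriv hα σ c)]
    with η e0 e1 e2 e3 e4 e5 e6
  rwa [e4, Pi.sub_apply, e5, Pi.sub_apply, e6, Pi.smul_apply, e1, e2, e3]

theorem norm_expVecDeriv_sub_le (hα : α < α₀) (ϱ σ : DeltaPlus d α₀)
    (c c' : Lp ℝ ∞ (volume : Measure (Pos d))) :
    ‖expVecDeriv hα ϱ c - expVecDeriv hα σ c'‖ ≤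
      quadConst α α₀ * (‖c'‖ * ‖ϱ.1 - σ.1‖) + linConst α α₀ * ‖c - c'‖ := by
  have h1 := linConst_nonneg hα
  have h2 := quadConst_nonneg (α := α) (α₀ := α₀)
  refine KSpace.norm_le_of_ae (by positivity) ?_
  filter_upwards [weight_mul_abs_lpExpDeriv_sub_le hα ϱ.2 σ.2 c c', rep_expVecDeriv hα ϱ c,
    rep_expVecDeriv hα σ c', KSpace.rep_sub (expVecDeriv hα ϱ c) (expVecDeriv hα σ c')]
    with η e0 e1 e2 e3
  rwa [e3, Pi.sub_apply, e1, e2]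

theorem continuous_expVec (hα : α < α₀) : Continuous (expVec (d := d) hα) := by
  rw [continuous_iff_continuousAt]
  intro σ
  rw [ContinuousAt, tendsto_iff_norm_sub_tendsto_zero]
  have hlim : Tendsto (fun ϱ : DeltaPlus d α₀ => quadConst α α₀ * ‖ϱ.1 - σ.1‖ ^ 2 +
      linConst α α₀ * ‖ϱ.1 - σ.1 - (0 : ℝ) • σ.1‖) (𝓝 σ) (𝓝 0) := by
    have : Continuous (fun ϱ : DeltaPlus d α₀ => quadConst α α₀ * ‖ϱ.1 - σ.1‖ ^ 2 +
      linConst α α₀ * ‖ϱ.1 - σ.1 - (0 : ℝ) • σ.1‖) := by fun_prop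
    simpa using this.tendsto σ
  refine squeeze_zero (fun _ => norm_nonneg _) (fun ϱ => ?_) hlim
  simpa using norm_expVec_sub_le hα ϱ σ 0 σ.1

theorem continuous_expVecDeriv (hα : α < α₀) :
    Continuous fun p : DeltaPlus d α₀ × Lp ℝ ∞ (volume : Measure (Pos d)) =>
      expVecDeriv hα p.1 p.2 := by
  rw [continuous_iff_continuousAt]
  intro q
  rw [ContinuousAt, tendsto_iff_norm_sub_tendsto_zero]
  have hlim : Tendsto (fun p : DeltaPlus d α₀ × Lp ℝ ∞ (volume : Measure (Pos d)) =>
      quadConst α α₀ * (‖q.2‖ * ‖p.1.1 - q.1.1‖) + linConst α α₀ * ‖p.2 - q.2‖) (𝓝 q) (𝓝 0) := by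
    have : Continuous (fun p : DeltaPlus d α₀ × Lp ℝ ∞ (volume : Measure (Pos d)) =>
      quadConst α α₀ * (‖q.2‖ * ‖p.1.1 - q.1.1‖) + linConst α α₀ * ‖p.2 - q.2‖) := by fun_prop
    simpa using this.tendsto q
  exact squeeze_zero (fun _ => norm_nonneg _)
    (fun p => norm_expVecDeriv_sub_le hα p.1 q.1 p.2 q.2) hlim

/-- The remainder is quadratic in the increment of `ϱ` plus linear in its linearization error, and
both are `o(s - t)`. Differentiation is along curves because the estimates hold only inside
`DeltaPlus`. -/
theorem hasDerivAt_expVec (hα : α < α₀) {ϱ : ℝ → DeltaPlus d α₀}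
    {c : Lp ℝ ∞ (volume : Measure (Pos d))} {t : ℝ} (h : HasDerivAt (fun s => (ϱ s).1) c t) :
    HasDerivAt (fun s => expVec hα (ϱ s)) (expVecDeriv hα (ϱ t) c) t := by
  rw [hasDerivAt_iff_isLittleO] at h ⊢
  have h1 : (fun s => (ϱ s).1 - (ϱ t).1) =O[𝓝 t] fun s => s - t :=
    (hasDerivAt_iff_isLittleO.2 h).isBigO_sub
  have h2 : (fun s => ‖(ϱ s).1 - (ϱ t).1‖ ^ 2) =o[𝓝 t] fun s => s - t := by
    refine (h1.norm_left.pow 2).trans_isLittleO ?_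
    have h3 : (fun s : ℝ => s - t) =o[𝓝 t] fun _ => (1 : ℝ) := by
      rw [Asymptotics.isLittleO_one_iff]
      have : Continuous fun s : ℝ => s - t := by fun_prop
      simpa using this.tendsto t
    simpa [pow_two] using h3.mul_isBigO (Asymptotics.isBigO_refl (fun s : ℝ => s - t) (𝓝 t))
  refine Asymptotics.IsBigO.trans_isLittleO (Asymptotics.IsBigO.of_norm_le fun s =>
    norm_expVec_sub_le hα (ϱ s) (ϱ t) (s - t) c) ?_
  exact (h2.const_mul_left _).add (h.norm_left.const_mul_left _)

/-- The Vlasov equation for `ϱ` turns into the Vlasov hierarchy for `e(ϱ, ·)`. -/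
theorem vlasovGraph_expVec {φ : Pos d → ℝ} (hφ_nonneg : ∀ x, 0 ≤ φ x) (hφ : Integrable φ) {ϰ : ℝ}
    (hα : α < α₀) (ϱ : DeltaPlus d α₀) {c : Lp ℝ ∞ (volume : Measure (Pos d))}
    (h : VlasovEqGraph φ ϰ ϱ.1 c) : VlasovGraph φ ϰ α (expVec hα ϱ) (expVecDeriv hα ϱ c) := by
  classical
  refine ⟨?_, ?_⟩
  · filter_upwards [integrable_and_abs_integral_replace_le hφ_nonneg hφ (expVec hα ϱ)] with η h x hx
    exact (h x hx).1
  · filter_upwards [rep_expVecDeriv hα ϱ c, rep_expVec hα ϱ, ae_replace (rep_expVec hα ϱ),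
      ae_forall_mem h] with η e1 e2 e3 e4
    -- For almost every `ξ` the exponent of `(η \ x) ∪ ξ` splits, and the factors in `ξ` combine to
    -- `e(-φ(x - ·) ϱ, ξ)`, whose integral is an exponential.
    have hint : ∀ x ∈ η.pts,
        ∫ ξ, lpExp (fun y => -φ (x - y)) ξ * (expVec hα ϱ).rep (η.replace x ξ)
          ∂(lebesguePoisson d) =
        (∏ y ∈ η.pts.erase x, ϱ.1 y) * Real.exp (-∫ y, φ (x - y) * ϱ.1 y) := by
      intro x hx
      have hI : Integrable fun y => -(φ (x - y) * ϱ.1 y) := (integrable_conv hφ ϱ.1 x).neg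
      rw [← integral_neg, ← integral_lpExp hI, ← integral_const_mul]
      refine integral_congr_ae ?_
      filter_upwards [e3 x hx, ae_disjoint (η.pts.erase x)] with ξ h1 h2
      have h3 : lpExp ϱ.1 (η.replace x ξ) = (∏ y ∈ η.pts.erase x, ϱ.1 y) * lpExp ϱ.1 ξ := by
        rw [lpExp, lpExp, ← Finset.prod_union h2]
        unfold Conf.replace
        congr!
      rw [h1, h3, mul_left_comm]
      congr 1
      rw [lpExp, lpExp, lpExp, ← Finset.prod_mul_distrib]
      exact Finset.prod_congr rfl fun y _ => neg_mul _ _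
    rw [e1, vlasovOp, Finset.sum_congr rfl hint, e2, Finset.mul_sum, Conf.card]
    -- Distributing `-|η|` over the points reduces the claim to the density equation at each `x ∈
    -- η`.
    have h5 : -(η.pts.card : ℝ) * lpExp ϱ.1 η = ∑ x ∈ η.pts, -lpExp ϱ.1 η := by
      rw [Finset.sum_const, nsmul_eq_mul]
      ring
    rw [h5, ← Finset.sum_add_distrib]
    refine Finset.sum_congr rfl fun x hx => ?_
    rw [e4 x hx, lpExp, ← Finset.mul_prod_erase _ _ hx]
    ring

end ExponentialVectors

end Vlasov

end

/-! ### The main theorem. -/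

theorem theorem4p3 (d : ℕ) (hd : 1 ≤ d)
    (φ : Vlasov.Pos d → ℝ) (hφ_nonneg : ∀ x, 0 ≤ φ x) (hφ_even : ∀ x, φ (-x) = φ x)
    (hφ_int : Integrable φ volume)
    (ϰ α₀ : ℝ) (hϰ : 0 < ϰ) (hϰα₀ : ϰ ≤ Real.exp (-α₀))
    (ϱ₀ : Lp ℝ ∞ (volume : Measure (Vlasov.Pos d))) (hϱ₀ : ϱ₀ ∈ Vlasov.DeltaPlus d α₀) :
    ∃ ϱ : ℝ → Lp ℝ ∞ (volume : Measure (Vlasov.Pos d)),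
      Vlasov.IsClassicalSolution (Vlasov.VlasovEqGraph φ ϰ) ϱ₀ ⊤ ϱ ∧
      (∀ (T : EReal) (σ : ℝ → Lp ℝ ∞ (volume : Measure (Vlasov.Pos d))),
        Vlasov.IsClassicalSolution (Vlasov.VlasovEqGraph φ ϰ) ϱ₀ T σ →
          ∀ t : ℝ, 0 ≤ t → (t : EReal) < T → σ t = ϱ t) ∧
      (∀ t : ℝ, 0 ≤ t → ϱ t ∈ Vlasov.DeltaPlus d α₀) ∧
      ∀ α : ℝ, α < α₀ →
        ∃ r₀ : Vlasov.KSpace d α,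
          r₀.rep =ᵐ[Vlasov.lebesguePoisson d] Vlasov.lpExp ϱ₀ ∧
          ∃ r : ℝ → Vlasov.KSpace d α,
            Vlasov.IsClassicalSolution (Vlasov.VlasovGraph φ ϰ α) r₀ ⊤ r ∧
            (∀ (T : EReal) (s : ℝ → Vlasov.KSpace d α),
              Vlasov.IsClassicalSolution (Vlasov.VlasovGraph φ ϰ α) r₀ T s →
                ∀ t : ℝ, 0 ≤ t → (t : EReal) < T → s t = r t) ∧
            ∀ t : ℝ, 0 ≤ t →
              (r t).rep =ᵐ[Vlasov.lebesguePoisson d] Vlasov.lpExp (ϱ t) := by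
  have := Vlasov.nontrivial_pos hd
  obtain ⟨ϱ, h0, hdiff, hcont', hΔ, hgraph⟩ :=
    Vlasov.exists_solution_vlasovEq hφ_nonneg hφ_int hϰ hϰα₀ hϱ₀
  have hlt : ∀ {T : EReal} {s t : ℝ}, s ≤ t → (t : EReal) < T → (s : EReal) < T :=
    fun h h' => (EReal.coe_le_coe_iff.2 h).trans_lt h'
  refine ⟨ϱ, ⟨h0, hdiff.continuous.continuousOn, fun t _ _ => hdiff t, hcont'.continuousOn,
    fun t ht _ => hgraph t ht.le⟩, fun T σ hσ t ht htT => ?_, hΔ, fun α hα => ?_⟩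
  · exact Vlasov.vlasovEq_unique hφ_int (b := t)
      (hσ.continuousOn.mono fun s hs => ⟨hs.1, hlt hs.2 htT⟩)
      (fun s hs => ⟨hσ.differentiableAt s hs.1 (hlt hs.2.le htT),
        hσ.equation s hs.1 (hlt hs.2.le htT)⟩)
      hdiff.continuous.continuousOn (fun s hs => ⟨hdiff s, hgraph s hs.1.le⟩)
      (hσ.initial.trans h0.symm) ⟨ht, le_rfl⟩
  -- Membership in `DeltaPlus` is known only for `t ≥ 0`. Freezing the curve at negative times makes
  -- `expVec` defined everywhere and leaves derivatives at `t > 0` unchanged.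
  · set σ : ℝ → Vlasov.DeltaPlus d α₀ := fun t => ⟨ϱ (max t 0), hΔ _ (le_max_right _ _)⟩ with hσ
    have hσval : ∀ t, 0 ≤ t → (σ t).1 = ϱ t := fun t ht => by simp only [hσ, max_eq_left ht]
    have hσcont : Continuous σ :=
      (hdiff.continuous.comp (continuous_id.max continuous_const)).subtype_mk _
    have hσ0 : σ 0 = ⟨ϱ₀, hϱ₀⟩ := Subtype.ext ((hσval 0 le_rfl).trans h0)
    have hder : ∀ t, 0 < t → HasDerivAt (fun s => Vlasov.expVec hα (σ s))
        (Vlasov.expVecDeriv hα (σ t) (deriv ϱ t)) t := by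
      intro t ht
      refine Vlasov.hasDerivAt_expVec hα ((hdiff t).hasDerivAt.congr_of_eventuallyEq ?_)
      filter_upwards [lt_mem_nhds ht] with s hs using hσval s (le_of_lt hs)
    have hvgraph : ∀ t, 0 < t → Vlasov.VlasovGraph φ ϰ α (Vlasov.expVec hα (σ t))
        (Vlasov.expVecDeriv hα (σ t) (deriv ϱ t)) := by
      intro t ht
      refine Vlasov.vlasovGraph_expVec hφ_nonneg hφ_int hα (σ t) ?_
      rw [hσval t ht.le]
      exact hgraph t ht.le
    have hrcont : Continuous fun t => Vlasov.expVec hα (σ t) :=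
      (Vlasov.continuous_expVec hα).comp hσcont
    refine ⟨Vlasov.expVec hα ⟨ϱ₀, hϱ₀⟩, Vlasov.rep_expVec hα _, fun t => Vlasov.expVec hα (σ t),
      ⟨by rw [hσ0], hrcont.continuousOn, fun t ht _ => (hder t ht).differentiableAt, ?_,
        fun t ht _ => ?_⟩, fun T s hs t ht htT => ?_, fun t ht => ?_⟩
    · refine ((Vlasov.continuous_expVecDeriv hα).comp
        (hσcont.prodMk hcont')).continuousOn.congr fun t ht => (hder t ht.1).deriv
    · rw [(hder t ht).deriv]
      exact hvgraph t ht
    · refine sub_eq_zero.1 (Vlasov.eq_zero_of_vlasovGraph hφ_nonneg hφ_int hϰ.le (b := t)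
        (w := fun u => s u - Vlasov.expVec hα (σ u))
        (w' := fun u => deriv s u - Vlasov.expVecDeriv hα (σ u) (deriv ϱ u))
        ((hs.continuousOn.mono fun u hu => ⟨hu.1, hlt hu.2 htT⟩).sub hrcont.continuousOn)
        (fun u hu => ?_) (fun u hu => ?_) ?_ t ⟨ht, le_rfl⟩)
      · exact (hs.differentiableAt u hu.1 (hlt hu.2.le htT)).hasDerivAt.sub (hder u hu.1)
      · exact (hs.equation u hu.1 (hlt hu.2.le htT)).sub hφ_nonneg hφ_int (hvgraph u hu.1)
      · rw [hs.initial, hσ0, sub_self]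
    · rw [← hσval t ht]
      exact Vlasov.rep_expVec hα (σ t)
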